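/- **Corollary (Exponential convergence w.r.t. the $\ell_2$-$\ell_1$ loss).** *Setting.* Let $J\ge 1$, $d_0,\dots,d_J\ge 1$, and let $D_j\in\mathbb{R}^{d_{j-1}\times d_j}$ ($j=1,\dots,J$) be dictionaries whose columns have Euclidean norm $1$. Let $\mu(D_j)$ be the mutual coherence of $D_j$, i.e. the maximum of $|a_i^\top a_k|/(\|a_i\|_2\|a_k\|_2)$ over pairs of distinct columns ($0$ if there is only one column). Let $\lambda=(\lambda_1,\dots,\lambda_J)$, $\lambda_j\ge 0$, satisfy $\lambda_j<\frac12\bigl(1+\frac1{\mu(D_j)}\bigr)$ for all $j$ (no restriction when $\mu(D_j)=0$). For an observation $y=x_0\in\mathbb{R}^{d_0}$, vectors $x_j\in\mathbb{R}^{d_j}$ are called noiseless sparse codings of $y$ if $x_{j-1}=D_jx_j$ and $\|x_j\|_0\le\lambda_j$ for $j=1,\dots,J$. For $\gamma>0$ put $$L_j(z)=\|x_{j-1}-D_jz\|_2^2+\gamma\|z\|_1,\qquad z\in\mathbb{R}^{d_j}.$$ *Networks.* A CNN with kernel size $s$ is a one-dimensional multi-channel network with hidden layers $h_0(y)=y$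 (one channel) and $$h_{k}(y)_\ell=\sigma\Bigl(\sum_{i=1}^{n_{k-1}} w^{(k)}_{\ell,i}*_{t_k}h_{k-1}(y)_i+b^{(k)}_\ell\mathbf 1\Bigr),\qquad \ell=1,\dots,n_k,$$ with $\sigma(u)=\max\{u,0\}$, filters $w^{(k)}_{\ell,i}\in\mathbb{R}^s$, biases $b^{(k)}_\ell\in\mathbb{R}$, strides $t_k\ge1$, where for $w\in\mathbb{R}^s$ and $x\in\mathbb{R}^d$, $(w*_tx)_i=\sum_{m=1}^s w_mx_{(i-1)t+m}$ for $1\le i\le\lceil d/t\rceil$, with $x_r=0$ for $r\notin[1,d]$. It has $J$ outputs; the $j$-th output in $\mathbb{R}^{d_j}$ is produced by a convolutional output layer of the same form (kernel size $s$) but without activation, with $d_j$ channels of length one, on top of the $k_j$-th layer $h_{k_j}$, where $k_1<\dots<k_J$. Its depth is the number of hidden layers plus one, and its number of weights counts all entries of filters and all biases of all hidden and output layers. *Claim.* There are constants $A_s>0$ depending only on $s$, a constant $c=c_{D,\lambda}>0$ depending only on $\{D_j\}$ and $\lambda$, and, for each $B\ge0$, a constant $C=C_{D,B,\lambda}>0$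 depending only on $\{D_j\}$, $B$ and $\lambda$, such that for all $\gamma>0$, all integers $s\ge2$ and all integers $K\ge1$ there exists a CNN with kernel size $s$, depth at most $$A_s\,K\log_s\prod_{j=1}^J(d_{j-1}+d_j)$$ and at most $$A_s\,K\prod_{j=1}^J(d_{j-1}+d_j)^2$$ weights such that, for every $y\in\mathbb{R}^{d_0}$ and all noiseless sparse codings $\{x_j\}_{j=1}^J$ of $y$ whose entries are all bounded by $B$ in absolute value, the outputs $\tilde x_1,\dots,\tilde x_J$ of the CNN on the input $y$ satisfy $$0\le L_j(\tilde x_j)-L_j(x_j)\le C\,(1+\gamma)\,e^{-cK},\qquad j=1,\dots,J.$$ -/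

import Mathlib

open scoped NNReal ENNReal

noncomputable section

/-! ### Norms, mutual coherence, deep sparse coding -/

/-- The Euclidean norm of a vector of `ℝⁿ`. -/
def l2norm {n : ℕ} (v : Fin n → ℝ) : ℝ := ‖WithLp.toLp 2 v‖

/-- The `ℓ₁` norm of a vector of `ℝⁿ`. -/
def l1norm {n : ℕ} (v : Fin n → ℝ) : ℝ := ∑ i, |v i|

/-- The number of nonzero entries of a vector of `ℝⁿ`. -/
def l0norm {n : ℕ} (v : Fin n → ℝ) : ℕ := (Function.support v).ncard

/-- The matrix has columns of Euclidean norm one. -/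
def ColumnNormalized {m n : ℕ} (A : Matrix (Fin m) (Fin n) ℝ) : Prop :=
  ∀ k, l2norm (fun i => A i k) = 1

/-- The mutual coherence `max_{i ≠ j} |aᵢᵀ aⱼ| / (‖aᵢ‖₂ ‖aⱼ‖₂)` over the columns of `A`
(a maximum over finitely many pairs; it is `0` when there is only one column). -/
def mutualCoherence {m n : ℕ} (A : Matrix (Fin m) (Fin n) ℝ) : ℝ :=
  ⨆ p : {p : Fin n × Fin n // p.1 ≠ p.2},
    |∑ i, A i p.1.1 * A i p.1.2| /
      (l2norm (fun i => A i p.1.1) * l2norm (fun i => A i p.1.2))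

/-- The condition `l < (1 + 1 / μ(A)) / 2`, computed in `[0, ∞]`, so that `1 / μ(A) = ∞` when
`μ(A) = 0` (orthogonal columns), in which case there is no restriction on `l`. -/
def UniquenessCondition {m n : ℕ} (A : Matrix (Fin m) (Fin n) ℝ) (l : ℝ≥0) : Prop :=
  (l : ℝ≥0∞) < (1 + (ENNReal.ofReal (mutualCoherence A))⁻¹) / 2

/-- `x 1, …, x J` are sparse codings of the observation `x 0`, for the dictionaries
`D 0, …, D (J - 1)` (which stand for `D₁, …, D_J`), the sparsity levels `lam` and the tolerances
`ε`: for each `j`, `‖x_{j-1} - D_j x_j‖₂ ≤ ε_j` and `‖x_j‖₀ ≤ λ_j`. -/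
def IsDeepSparseCoding {J : ℕ} {d : Fin (J + 1) → ℕ}
    (D : ∀ j : Fin J, Matrix (Fin (d j.castSucc)) (Fin (d j.succ)) ℝ)
    (lam ε : Fin J → ℝ≥0) (x : ∀ j : Fin (J + 1), Fin (d j) → ℝ) : Prop :=
  ∀ j : Fin J,
    l2norm (x j.castSucc - (D j).mulVec (x j.succ)) ≤ ε j ∧
    (l0norm (x j.succ) : ℝ) ≤ lam j

/-- The `ℓ₂`-`ℓ₁` loss `z ↦ ‖u - A z‖₂² + γ ‖z‖₁`. -/
def l2l1Loss {m n : ℕ} (γ : ℝ) (A : Matrix (Fin m) (Fin n) ℝ) (u : Fin m → ℝ)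
    (z : Fin n → ℝ) : ℝ :=
  l2norm (u - A.mulVec z) ^ 2 + γ * l1norm z

/-! ### One-dimensional multi-channel convolutional neural networks -/

/-- The convolution of a kernel `w` of size `s` with a signal `x` of length `d`, with stride `t`:
the vector of length `⌈d / t⌉` with entries `∑ k, w k * x (i * t + k)` (indices from `0`), where
`x` is `0` outside of its range. -/
def strideConv {s d : ℕ} (w : Fin s → ℝ) (t : ℕ) (x : Fin d → ℝ) : Fin (d ⌈/⌉ t) → ℝ :=
  fun i => ∑ k : Fin s,
    w k * (if h : (i : ℕ) * t + (k : ℕ) < d then x ⟨(i : ℕ) * t + (k : ℕ), h⟩ else 0)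

/-- The weights of a convolutional layer with kernel size `s`, `n` input channels and `n'` output
channels: one filter for each pair of channels, one bias for each output channel. -/
structure ConvWeights (s n n' : ℕ) where
  filter : Fin n' → Fin n → Fin s → ℝ
  bias : Fin n' → ℝ

/-- The affine part of a convolutional layer with stride `t`. -/
def ConvWeights.affine {s n n' d : ℕ} (W : ConvWeights s n n') (t : ℕ)
    (x : Fin n → Fin d → ℝ) : Fin n' → Fin (d ⌈/⌉ t) → ℝ :=
  fun l i => (∑ c, strideConv (W.filter l c) t (x c) i) + W.bias l

/-- A one-dimensional multi-channel DCNN with input size `d` and kernel size `s`. The layers are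
numbered `1, …, numLayers`; layer `k + 1` has stride `stride k`, weights `weights k`, and maps
`chan k` channels to `chan (k + 1)` channels. (The values of the fields for larger indices play
no role.) -/
structure DCNN (s d : ℕ) where
  numLayers : ℕ
  stride : ℕ → ℕ
  stride_pos : ∀ k, 1 ≤ stride k
  chan : ℕ → ℕ
  chan_zero : chan 0 = 1
  chan_pos : ∀ k, 1 ≤ chan k
  weights : ∀ k, ConvWeights s (chan k) (chan (k + 1))

/-- The length of each channel of layer `k`: `d₀ = d`, `d_{k+1} = ⌈d_k / t_{k+1}⌉`. -/
def DCNN.len {s d : ℕ} (N : DCNN s d) : ℕ → ℕ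
  | 0 => d
  | k + 1 => N.len k ⌈/⌉ N.stride k

/-- The features `h_k(y)` of layer `k` on the input `y`, with the ReLU activation. -/
def DCNN.hidden {s d : ℕ} (N : DCNN s d) (y : Fin d → ℝ) :
    ∀ k : ℕ, Fin (N.chan k) → Fin (N.len k) → ℝ
  | 0 => fun _ => y
  | k + 1 => fun l i => max ((N.weights k).affine (N.stride k) (N.hidden y k) l i) 0

/-- A DCNN with input size `d 0` and `J` outputs of sizes `d 1, …, d J`. All hidden layers are
those of a DCNN. The `j`-th output is produced by a convolutional output layer without activation
(so that it can take negative values) on top of layer `tap j`; the output layer has `d_j` channels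
of length one, which are regarded as a vector of length `d_j`. Later outputs sit on top of deeper
layers. -/
structure DeepCodingCNN (s J : ℕ) (d : Fin (J + 1) → ℕ) where
  net : DCNN s (d 0)
  tap : Fin J → ℕ
  tap_le : ∀ j, tap j ≤ net.numLayers
  tap_strictMono : StrictMono tap
  outStride : Fin J → ℕ
  outStride_pos : ∀ j, 1 ≤ outStride j
  outLen : ∀ j, net.len (tap j) ⌈/⌉ outStride j = 1
  outWeights : ∀ j : Fin J, ConvWeights s (net.chan (tap j)) (d j.succ)

namespace DeepCodingCNN

variable {s J : ℕ} {d : Fin (J + 1) → ℕ}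

/-- The `j`-th output of the network on the input `y`. -/
def output (N : DeepCodingCNN s J d) (y : Fin (d 0) → ℝ) (j : Fin J) : Fin (d j.succ) → ℝ :=
  fun i => (N.outWeights j).affine (N.outStride j) (N.net.hidden y (N.tap j)) i
    ⟨0, by rw [N.outLen j]; exact Nat.one_pos⟩

/-- The depth: the number of hidden layers, plus one for the output layer. -/
def depth (N : DeepCodingCNN s J d) : ℕ := N.net.numLayers + 1

/-- The number of weights: all entries of all filters and all biases (zero or not), of the hidden
layers and of the output layers. -/
def numWeights (N : DeepCodingCNN s J d) : ℕ :=
  (∑ k ∈ Finset.range N.net.numLayers,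
      (N.net.chan (k + 1) * N.net.chan k * s + N.net.chan (k + 1))) +
    ∑ j : Fin J, (d j.succ * N.net.chan (N.tap j) * s + d j.succ)

end DeepCodingCNN

end

/-! ### Norm estimates for column-normalized matrices -/

/-! The network runs iterative soft thresholding for all dictionaries at once. For unit columns with
coherence `μ`, the matrix `AᵀA - I` has zero diagonal and entries at most `μ`. So if `z` has no
false support and `‖x - z‖₁ ≤ E`, a gradient step lands within `μE` of `x` in each entry.
Thresholding at `μE` then creates no false support and leaves an `ℓ₁` error of at most `(2‖x‖₀ -
1)μE`. The uniqueness condition says exactly that this factor is below one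
(`UniquenessCondition.mul_lt_one`, `ColumnNormalized.l1norm_sub_thresholdStep_le`).

The step for `x_j` sees only the current approximation of `x_{j-1}`, whose error acts as noise.
Allowing errors `Q ^ j * τ` with `Q` large absorbs this noise, and `τ` shrinks by a common factor `ρ
< 1` (`IsCodeApprox.step`). The scale starts at `τ = ‖y‖₁`, computed by the network itself. The
iteration is thus positively homogeneous, and the error after `K` steps is at most `q‖x_j‖₁` with
`q` proportional to `ρ ^ K`.

A relative error is what the lower bound on the loss needs. The residual of `x_j` is zero, so it
suffices that the output has at least the `ℓ₁` norm of `x_j`; scaling by `1 + 2q` ensures this if `q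
≤ 1/2`. Otherwise the constant output `B` will do, as the claimed bound is then of constant size
(`ColumnNormalized.loss_affine_bounds`).

Soft thresholding is a difference of two rectifiers, so one step is one ReLU layer acting on
positive parts, negative parts and `τ` (`codingValue_codingState_succ`). To reach such fully
connected layers, layers of stride `s` first move the entries of `y` into channels of length one
(`serialNet_hidden_serial`). The size bounds rest on `succ_card_mul_sum_sq_le`, which absorbs the
number `J` of dictionaries into the product. -/

theorem l2norm_sq {n : ℕ} (v : Fin n → ℝ) : l2norm v ^ 2 = ∑ i, v i ^ 2 := by
  simp [l2norm, EuclideanSpace.real_norm_sq_eq]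

theorem l2norm_nonneg {n : ℕ} (v : Fin n → ℝ) : 0 ≤ l2norm v := norm_nonneg _

theorem l1norm_nonneg {n : ℕ} (v : Fin n → ℝ) : 0 ≤ l1norm v :=
  Finset.sum_nonneg fun _ _ => abs_nonneg _

theorem l1norm_add_le {n : ℕ} (v w : Fin n → ℝ) : l1norm (v + w) ≤ l1norm v + l1norm w := by
  unfold l1norm
  rw [← Finset.sum_add_distrib]
  exact Finset.sum_le_sum fun i _ => abs_add_le _ _

theorem l1norm_smul {n : ℕ} (a : ℝ) (v : Fin n → ℝ) : l1norm (a • v) = |a| * l1norm v := by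
  simp [l1norm, abs_mul, Finset.mul_sum]

theorem l1norm_sub_comm {n : ℕ} (v w : Fin n → ℝ) : l1norm (v - w) = l1norm (w - v) := by
  simp [l1norm, abs_sub_comm]

theorem l1norm_le_mul {n : ℕ} {v : Fin n → ℝ} {b : ℝ} (h : ∀ i, |v i| ≤ b) :
    l1norm v ≤ n * b := by
  unfold l1norm
  simpa using Finset.sum_le_card_nsmul Finset.univ (fun i => |v i|) b fun i _ => h i

namespace ColumnNormalized

variable {m n : ℕ} {A : Matrix (Fin m) (Fin n) ℝ}

theorem sum_mul_self (hA : ColumnNormalized A) (k : Fin n) : ∑ i, A i k * A i k = 1 := by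
  have h := l2norm_sq fun i => A i k
  rw [hA k] at h
  simpa [sq] using h.symm

theorem abs_entry_le (hA : ColumnNormalized A) (i : Fin m) (k : Fin n) : |A i k| ≤ 1 := by
  have h : A i k * A i k ≤ ∑ i, A i k * A i k :=
    Finset.single_le_sum (f := fun i => A i k * A i k) (fun _ _ => mul_self_nonneg _)
      (Finset.mem_univ i)
  rw [hA.sum_mul_self] at h
  exact abs_le_one_iff_mul_self_le_one.2 h

theorem abs_mulVec_le (hA : ColumnNormalized A) (z : Fin n → ℝ) (i : Fin m) :
    |A.mulVec z i| ≤ l1norm z := by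
  unfold l1norm Matrix.mulVec dotProduct
  refine (Finset.abs_sum_le_sum_abs _ _).trans (Finset.sum_le_sum fun k _ => ?_)
  rw [abs_mul]
  exact mul_le_of_le_one_left (abs_nonneg _) (hA.abs_entry_le i k)

theorem abs_transpose_mulVec_le (hA : ColumnNormalized A) (v : Fin m → ℝ) (k : Fin n) :
    |A.transpose.mulVec v k| ≤ l1norm v := by
  unfold l1norm Matrix.mulVec dotProduct
  refine (Finset.abs_sum_le_sum_abs _ _).trans (Finset.sum_le_sum fun i _ => ?_)
  rw [abs_mul]
  exact mul_le_of_le_one_left (abs_nonneg _) (hA.abs_entry_le i k)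

theorem l1norm_mulVec_le (hA : ColumnNormalized A) (z : Fin n → ℝ) :
    l1norm (A.mulVec z) ≤ m * l1norm z :=
  l1norm_le_mul (hA.abs_mulVec_le z)

theorem l2norm_mulVec_le (hA : ColumnNormalized A) (z : Fin n → ℝ) :
    l2norm (A.mulVec z) ≤ l1norm z := by
  have h : WithLp.toLp 2 (A.mulVec z) = ∑ k, z k • WithLp.toLp 2 (fun i => A i k) := by
    ext i
    simp [Matrix.mulVec, dotProduct, mul_comm]
  unfold l2norm
  rw [h]
  refine (norm_sum_le _ _).trans (Finset.sum_le_sum fun k _ => ?_)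
  rw [norm_smul, show ‖WithLp.toLp 2 (fun i => A i k)‖ = 1 from hA k, mul_one, Real.norm_eq_abs]

theorem abs_sum_mul_le (hA : ColumnNormalized A) {p q : Fin n} (h : p ≠ q) :
    |∑ i, A i p * A i q| ≤ mutualCoherence A := by
  have := le_ciSup (f := fun p : {p : Fin n × Fin n // p.1 ≠ p.2} =>
    |∑ i, A i p.1.1 * A i p.1.2| /
      (l2norm (fun i => A i p.1.1) * l2norm (fun i => A i p.1.2)))
    (Set.finite_range _).bddAbove ⟨(p, q), h⟩
  simp only [hA p, hA q, mul_one, div_one] at this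
  exact this

theorem abs_gram_sub_le (hA : ColumnNormalized A) (e : Fin n → ℝ) (i : Fin n) :
    |A.transpose.mulVec (A.mulVec e) i - e i| ≤ mutualCoherence A * (l1norm e - |e i|) := by
  have h1 : A.transpose.mulVec (A.mulVec e) i = ∑ k, (∑ l, A l i * A l k) * e k := by
    rw [Matrix.mulVec_mulVec]
    simp [Matrix.mulVec, dotProduct, Matrix.mul_apply]
  have h2 : l1norm e - |e i| = ∑ k ∈ Finset.univ.erase i, |e k| := by
    rw [l1norm, ← Finset.add_sum_erase _ _ (Finset.mem_univ i), add_sub_cancel_left]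
  rw [h1, ← Finset.add_sum_erase _ _ (Finset.mem_univ i), hA.sum_mul_self, one_mul,
    add_sub_cancel_left, h2, Finset.mul_sum]
  refine (Finset.abs_sum_le_sum_abs _ _).trans (Finset.sum_le_sum fun k hk => ?_)
  rw [abs_mul]
  exact mul_le_mul_of_nonneg_right (hA.abs_sum_mul_le (Finset.ne_of_mem_erase hk).symm)
    (abs_nonneg _)

end ColumnNormalized

theorem mutualCoherence_nonneg {m n : ℕ} (A : Matrix (Fin m) (Fin n) ℝ) :
    0 ≤ mutualCoherence A :=
  Real.iSup_nonneg fun _ =>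
    div_nonneg (abs_nonneg _) (mul_nonneg (l2norm_nonneg _) (l2norm_nonneg _))

theorem UniquenessCondition.mul_lt_one {m n : ℕ} {A : Matrix (Fin m) (Fin n) ℝ} {l : ℝ≥0}
    (h : UniquenessCondition A l) : (2 * l - 1) * mutualCoherence A < 1 := by
  rcases (mutualCoherence_nonneg A).eq_or_lt with h0 | h0
  · simp [← h0]
  unfold UniquenessCondition at h
  rw [← ENNReal.ofReal_inv_of_pos h0, ← ENNReal.ofReal_one,
    ← ENNReal.ofReal_add zero_le_one (inv_nonneg.2 h0.le),
    show (2 : ℝ≥0∞) = ENNReal.ofReal 2 by simp,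
    ← ENNReal.ofReal_div_of_pos two_pos, ENNReal.lt_ofReal_iff_toReal_lt (by simp)] at h
  have h1 : (2 * (l : ℝ) - 1) < (mutualCoherence A)⁻¹ := by
    simp only [ENNReal.coe_toReal] at h
    linarith
  calc _ < (mutualCoherence A)⁻¹ * mutualCoherence A := mul_lt_mul_of_pos_right h1 h0
    _ = 1 := inv_mul_cancel₀ h0.ne'

/-! ### Soft thresholding -/

/-- The soft thresholding function with threshold `θ`, as a difference of two rectifiers. -/
noncomputable def softThreshold (θ w : ℝ) : ℝ := max (w - θ) 0 - max (-w - θ) 0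

theorem softThreshold_zero (w : ℝ) : softThreshold 0 w = w := by
  unfold softThreshold
  rcases le_total w 0 with h | h
  · rw [max_eq_right (by linarith), max_eq_left (by linarith)]; ring
  · rw [max_eq_left (by linarith), max_eq_right (by linarith)]; ring

theorem softThreshold_eq_zero {θ w : ℝ} (h : |w| ≤ θ) : softThreshold θ w = 0 := by
  obtain ⟨h1, h2⟩ := abs_le.1 h
  rw [softThreshold, max_eq_right (by linarith), max_eq_right (by linarith), sub_zero]

theorem abs_softThreshold_sub_le {θ : ℝ} (hθ : 0 ≤ θ) (w : ℝ) :
    |softThreshold θ w - w| ≤ θ := by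
  rw [softThreshold, abs_le]
  rcases max_cases (w - θ) 0 with h | h <;> rcases max_cases (-w - θ) 0 with h' | h' <;>
    constructor <;> linarith [h.1, h.2, h'.1, h'.2]

/-! ### Iterative thresholding under a coherence condition -/

section Recovery

variable {m n : ℕ} {A : Matrix (Fin m) (Fin n) ℝ} {x z : Fin n → ℝ}

theorem l0norm_eq_card (x : Fin n → ℝ) : l0norm x = (Finset.univ.filter fun i => x i ≠ 0).card := by
  rw [l0norm, ← Set.ncard_coe_finset]
  congr 1
  ext i
  simp

theorem l0norm_le (x : Fin n → ℝ) : l0norm x ≤ n := by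
  rw [l0norm_eq_card]
  simpa using Finset.card_filter_le Finset.univ fun i => x i ≠ 0

theorem l1norm_eq_sum_support (h : ∀ i, x i = 0 → z i = 0) :
    l1norm z = ∑ i ∈ Finset.univ.filter (fun i => x i ≠ 0), |z i| := by
  symm
  refine Finset.sum_subset (Finset.subset_univ _) fun i _ hi => ?_
  simp only [Finset.mem_filter, Finset.mem_univ, true_and, not_not] at hi
  rw [h i hi, abs_zero]

theorem l1norm_eq_zero_of_l0norm (hx : l0norm x = 0) (h : ∀ i, x i = 0 → z i = 0) :
    l1norm z = 0 := by
  rw [l0norm_eq_card, Finset.card_eq_zero] at hx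
  rw [l1norm_eq_sum_support h, hx, Finset.sum_empty]

/-- If the entries of `w` are bounded by `a + b (‖e‖₁ - |eᵢ|)` on the support of `x`, and if `e` and
`w` are supported there, then `‖w‖₁ ≤ ‖x‖₀ a + (‖x‖₀ - 1) b ‖e‖₁`. -/
theorem l1norm_le_of_support {w e : Fin n → ℝ} {a b : ℝ} (hw : ∀ i, x i = 0 → w i = 0)
    (he : ∀ i, x i = 0 → e i = 0) (h : ∀ i, |w i| ≤ a + b * (l1norm e - |e i|)) :
    l1norm w ≤ l0norm x * a + (l0norm x - 1) * b * l1norm e := by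
  rw [l1norm_eq_sum_support hw]
  refine (Finset.sum_le_sum fun i _ => h i).trans_eq ?_
  rw [Finset.sum_add_distrib, ← Finset.mul_sum, Finset.sum_sub_distrib,
    ← l1norm_eq_sum_support he, l0norm_eq_card]
  simp only [Finset.sum_const, nsmul_eq_mul]
  ring

/-- The gradient step followed by soft thresholding. -/
noncomputable def thresholdStep (A : Matrix (Fin m) (Fin n) ℝ) (θ : ℝ) (u : Fin m → ℝ)
    (z : Fin n → ℝ) : Fin n → ℝ :=
  fun i => softThreshold θ ((z + A.transpose.mulVec (u - A.mulVec z)) i)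

/-- The deviation is `Aᵀ(u - Ax) + (AᵀA - I)(x - z)`: noise in the observation plus interference
between distinct columns. -/
theorem ColumnNormalized.abs_gradientStep_sub_le (hA : ColumnNormalized A) (u : Fin m → ℝ)
    (i : Fin n) :
    |(z + A.transpose.mulVec (u - A.mulVec z)) i - x i| ≤
      l1norm (u - A.mulVec x) + mutualCoherence A * (l1norm (x - z) - |(x - z) i|) := by
  have h : (z + A.transpose.mulVec (u - A.mulVec z)) i - x i =
      A.transpose.mulVec (u - A.mulVec x) i +
        (A.transpose.mulVec (A.mulVec (x - z)) i - (x - z) i) := by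
    simp only [Matrix.mulVec_sub, Pi.add_apply, Pi.sub_apply]
    ring
  rw [h]
  exact (abs_add_le _ _).trans
    (add_le_add (hA.abs_transpose_mulVec_le _ i) (hA.abs_gram_sub_le _ i))

/-- The threshold is the worst-case size of the gradient step at an entry where `x` vanishes. -/
theorem ColumnNormalized.thresholdStep_eq_zero (hA : ColumnNormalized A) {u : Fin m → ℝ} {E ν : ℝ}
    (hu : l1norm (u - A.mulVec x) ≤ ν) (hE : l1norm (x - z) ≤ E) {i : Fin n} (hi : x i = 0) :
    thresholdStep A (mutualCoherence A * E + ν) u z i = 0 := by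
  apply softThreshold_eq_zero
  have h1 := hA.abs_gradientStep_sub_le (x := x) (z := z) u i
  rw [hi, sub_zero] at h1
  have h2 := mul_le_mul_of_nonneg_left
    (show l1norm (x - z) - |(x - z) i| ≤ E by linarith [abs_nonneg ((x - z) i)])
    (mutualCoherence_nonneg A)
  linarith

/-- On the support, interference contributes `(‖x‖₀ - 1)μE` in total and the shift by the threshold
another `‖x‖₀μE`. Their sum is the source of `2‖x‖₀ - 1`. The noise enters twice, once directly and
once through the threshold. -/
theorem ColumnNormalized.l1norm_sub_thresholdStep_le (hA : ColumnNormalized A) {u : Fin m → ℝ}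
    {E ν r : ℝ} (hu : l1norm (u - A.mulVec x) ≤ ν) (hE : l1norm (x - z) ≤ E)
    (hz : ∀ i, x i = 0 → z i = 0) (hr : 0 ≤ r)
    (hxr : (2 * (l0norm x : ℝ) - 1) * mutualCoherence A ≤ r) :
    l1norm (x - thresholdStep A (mutualCoherence A * E + ν) u z) ≤ r * E + 2 * n * ν := by
  have hμ := mutualCoherence_nonneg A
  have hν : 0 ≤ ν := (l1norm_nonneg _).trans hu
  have hE0 : 0 ≤ E := (l1norm_nonneg _).trans hE
  have hw : ∀ i, x i = 0 → (x - thresholdStep A (mutualCoherence A * E + ν) u z) i = 0 := by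
    intro i hi
    rw [Pi.sub_apply, hA.thresholdStep_eq_zero hu hE hi, hi, sub_zero]
  have he : ∀ i, x i = 0 → (x - z) i = 0 := fun i hi => by
    rw [Pi.sub_apply, hz i hi, hi, sub_zero]
  -- For `x = 0` the coefficient `‖x‖₀ - 1` is negative, and `‖x - z‖₁` could not be replaced by its
  -- upper bound `E` below.
  rcases Nat.eq_zero_or_pos (l0norm x) with h0 | h0
  · rw [l1norm_eq_zero_of_l0norm h0 hw]
    positivity
  have key := l1norm_le_of_support (a := mutualCoherence A * E + 2 * ν) (b := mutualCoherence A)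
    hw he fun i => by
      have h1 := hA.abs_gradientStep_sub_le (x := x) (z := z) u i
      have h2 := abs_softThreshold_sub_le (add_nonneg (mul_nonneg hμ hE0) hν)
        ((z + A.transpose.mulVec (u - A.mulVec z)) i)
      have h3 := abs_sub_le (thresholdStep A (mutualCoherence A * E + ν) u z i)
        ((z + A.transpose.mulVec (u - A.mulVec z)) i) (x i)
      rw [Pi.sub_apply, abs_sub_comm]
      unfold thresholdStep at h3 ⊢
      linarith
  have h1 : (1 : ℝ) ≤ l0norm x := by exact_mod_cast h0
  have hn : (l0norm x : ℝ) ≤ n := by exact_mod_cast l0norm_le x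
  have h2 : ((l0norm x : ℝ) - 1) * mutualCoherence A * l1norm (x - z) ≤
      (l0norm x - 1) * mutualCoherence A * E :=
    mul_le_mul_of_nonneg_left hE (mul_nonneg (by linarith) hμ)
  have h3 := mul_le_mul_of_nonneg_right hxr hE0
  have h4 := mul_le_mul_of_nonneg_right hn hν
  linarith

/-- Up to interference, `x` is recovered as `AᵀAx`; summing over the support gives stable
injectivity on sparse vectors. This controls the error of the initial guess `0`. -/
theorem ColumnNormalized.mul_l1norm_le (hA : ColumnNormalized A) {r : ℝ}
    (hxr : (2 * (l0norm x : ℝ) - 1) * mutualCoherence A ≤ r) :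
    (1 - r) * l1norm x ≤ n * l1norm (A.mulVec x) := by
  have hμ := mutualCoherence_nonneg A
  have key := l1norm_le_of_support (x := x) (a := l1norm (A.mulVec x)) (b := mutualCoherence A)
    (fun _ h => h) (fun _ h => h) fun i => by
      have h1 := hA.abs_transpose_mulVec_le (A.mulVec x) i
      have h2 := hA.abs_gram_sub_le x i
      have h3 := abs_sub_abs_le_abs_sub (x i) (A.transpose.mulVec (A.mulVec x) i)
      rw [abs_sub_comm] at h3
      linarith
  have hn : (l0norm x : ℝ) ≤ n := by exact_mod_cast l0norm_le x
  have h4 := mul_le_mul_of_nonneg_right hn (l1norm_nonneg (A.mulVec x))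
  have h5 : ((l0norm x : ℝ) - 1) * mutualCoherence A ≤ r := by
    have : 0 ≤ (l0norm x : ℝ) * mutualCoherence A := by positivity
    linarith
  have h6 := mul_le_mul_of_nonneg_right h5 (l1norm_nonneg x)
  linarith

end Recovery

/-! ### Evaluation of convolutional layers -/

/-- Channel counts and lengths of a concrete network agree with their closed forms only
propositionally. Sums indexed by `ℕ` avoid casts between the `Fin` types. -/
theorem ConvWeights.affine_eq {s n n' d N t t' : ℕ} {b : ℝ} (W : ConvWeights s n n')
    {x : Fin n → Fin d → ℝ} {v : ℕ → ℕ → ℝ} (hv : ∀ c i, x c i = v c i) {F : ℕ → ℕ → ℝ}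
    {l : Fin n'} (hF : ∀ c m, W.filter l c m = F c m) (hN : n = N) (ht : t = t')
    (hb : W.bias l = b) (i : Fin (d ⌈/⌉ t)) :
    W.affine t x l i = (∑ c ∈ Finset.range N, ∑ m ∈ Finset.range s,
      F c m * (if (i : ℕ) * t' + m < d then v c (i * t' + m) else 0)) + b := by
  subst hN ht hb
  unfold ConvWeights.affine strideConv
  congr 1
  rw [← Fin.sum_univ_eq_sum_range (fun c => ∑ m ∈ Finset.range s,
    F c m * (if (i : ℕ) * t + m < d then v c (i * t + m) else 0))]
  refine Finset.sum_congr rfl fun c _ => ?_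
  rw [← Fin.sum_univ_eq_sum_range
    (fun m => F c m * (if (i : ℕ) * t + m < d then v c (i * t + m) else 0))]
  refine Finset.sum_congr rfl fun m _ => ?_
  rw [hF]
  split_ifs with h
  · rw [hv]
  · rfl

/-- A layer whose filters are concentrated at the first tap acts on the first entries of the
channels as a matrix. -/
theorem ConvWeights.affine_eq_of_forall_ne {s n n' d N t : ℕ} {b : ℝ} (W : ConvWeights s n n')
    (hs : 0 < s) (hd : d = 1) {x : Fin n → Fin d → ℝ} {v : ℕ → ℝ}
    (hv : ∀ c i, x c i = v c) {g : ℕ → ℝ} {l : Fin n'}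
    (hF : ∀ (c : Fin n) (m : Fin s), W.filter l c m = if (m : ℕ) = 0 then g c else 0)
    (hN : n = N) (hb : W.bias l = b) (i : Fin (d ⌈/⌉ t)) (hi : (i : ℕ) = 0) :
    W.affine t x l i = (∑ c ∈ Finset.range N, g c * v c) + b := by
  rw [W.affine_eq (v := fun c _ => v c) hv (F := fun c m => if m = 0 then g c else 0) hF hN rfl hb]
  congr 1
  refine Finset.sum_congr rfl fun c _ => ?_
  rw [Finset.sum_eq_single_of_mem 0 (Finset.mem_range.2 hs)]
  · simp [hi, hd]
  · intro m _ hm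
    simp [hm]

theorem DCNN.hidden_succ {s d : ℕ} (N : DCNN s d) (y : Fin d → ℝ) (k : ℕ)
    (l : Fin (N.chan (k + 1))) (i : Fin (N.len (k + 1))) :
    N.hidden y (k + 1) l i = max ((N.weights k).affine (N.stride k) (N.hidden y k) l i) 0 := rfl

/-! ### A recurrent network behind a layer-wise serialization of the input -/

/-- The positive part (`c` even) or the negative part (`c` odd) of the entry `q` of `y`, which is
`0` outside of the range of `y`. -/
noncomputable def signPart {d : ℕ} (y : Fin d → ℝ) (c q : ℕ) : ℝ :=
  if h : q < d then max ((-1) ^ c * y ⟨q, h⟩) 0 else 0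

theorem signPart_nonneg {d : ℕ} (y : Fin d → ℝ) (c q : ℕ) : 0 ≤ signPart y c q := by
  unfold signPart
  split_ifs
  exacts [le_max_right _ _, le_rfl]

theorem signPart_of_le {d : ℕ} (y : Fin d → ℝ) (c : ℕ) {q : ℕ} (h : d ≤ q) :
    signPart y c q = 0 := dif_neg h.not_gt

/-- The number of channels: `1`, then `2 s ^ k` for `k ≤ p`, then `n`. -/
def serialChan (s p n : ℕ) : ℕ → ℕ
  | 0 => 1
  | k + 1 => if k ≤ p then 2 * s ^ k else n

/-- The filters: the first layer separates positive and negative parts, the next `p` layers turn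
blocks of `s` consecutive entries into channels, then come `W₀` and the recurrent weights `W`. -/
noncomputable def serialFilter (s p : ℕ) {n : ℕ} (W₀ : Fin n → ℕ → ℝ) (W : Fin n → Fin n → ℝ) :
    ℕ → ℕ → ℕ → ℕ → ℝ
  | 0, l, _, m => if m = 0 then (-1) ^ l else 0
  | k + 1, l, c, m =>
    if k < p then (if l = m * (2 * s ^ k) + c then 1 else 0)
    else if m = 0 then
      (if h : l < n then
        (if k = p then W₀ ⟨l, h⟩ c else if h' : c < n then W ⟨l, h⟩ ⟨c, h'⟩ else 0)
      else 0)
    else 0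

/-- The network with the filters `serialFilter`, with zero biases. -/
noncomputable def serialNet (s d p L : ℕ) {n : ℕ} (hs : 0 < s) (hn : 0 < n) (W₀ : Fin n → ℕ → ℝ)
    (W : Fin n → Fin n → ℝ) : DCNN s d where
  numLayers := L
  stride k := if k = 0 then 1 else s
  stride_pos k := by split_ifs; exacts [le_rfl, hs]
  chan := serialChan s p n
  chan_zero := rfl
  chan_pos k := by
    cases k with
    | zero => exact le_rfl
    | succ k =>
      change 1 ≤ if k ≤ p then 2 * s ^ k else n
      split_ifs
      exacts [Nat.mul_pos two_pos (Nat.pow_pos hs), hn]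
  weights k := ⟨fun l c m => serialFilter s p W₀ W k l c m, fun _ => 0⟩

/-- The states of the recurrent part. -/
noncomputable def recurrentState {d n : ℕ} (s p : ℕ) (W₀ : Fin n → ℕ → ℝ) (W : Fin n → Fin n → ℝ)
    (y : Fin d → ℝ) : ℕ → Fin n → ℝ
  | 0 => fun a => max (∑ c ∈ Finset.range (2 * s ^ p), W₀ a c * signPart y c (c / 2)) 0
  | k + 1 => fun a => max (∑ b, W a b * recurrentState s p W₀ W y k b) 0

section SerialNet

variable {s d p L n : ℕ} (hs : 0 < s) (hn : 0 < n) (W₀ : Fin n → ℕ → ℝ) (W : Fin n → Fin n → ℝ)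

/-- Iterated ceilings are handled through the Galois connection between ceiling division and
multiplication, which composes. -/
theorem serialNet_len_le_iff (k x : ℕ) :
    (serialNet s d p L hs hn W₀ W).len (k + 1) ≤ x ↔ d ≤ s ^ k * x := by
  induction k generalizing x with
  | zero =>
    change d ⌈/⌉ 1 ≤ x ↔ _
    simp
  | succ k ih =>
    change (serialNet s d p L hs hn W₀ W).len (k + 1) ⌈/⌉ s ≤ x ↔ _
    rw [ceilDiv_le_iff_le_mul hs, ih, pow_succ, mul_assoc]

theorem serialNet_len_eq_one (hd : 0 < d) {k : ℕ} (hk : d ≤ s ^ k) :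
    (serialNet s d p L hs hn W₀ W).len (k + 1) = 1 := by
  have h1 := serialNet_len_le_iff (d := d) (p := p) (L := L) hs hn W₀ W k 1
  have h0 := serialNet_len_le_iff (d := d) (p := p) (L := L) hs hn W₀ W k 0
  rw [mul_one] at h1
  rw [mul_zero] at h0
  have := h1.2 hk
  have : ¬ _ := fun h => absurd (h0.1 h) hd.not_ge
  omega

/-- Each stride-`s` layer copies tap `m` of channel `c` into the new channel `m * (2 * s ^ k) + c`.
The offset is even, so the parity of a channel keeps recording the sign. The rectifier is harmless
on nonnegative values. -/
theorem serialNet_hidden_serial (y : Fin d → ℝ) {k : ℕ} (hk : k ≤ p) (l i) :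
    (serialNet s d p L hs hn W₀ W).hidden y (k + 1) l i =
      signPart y l ((i : ℕ) * s ^ k + (l : ℕ) / 2) := by
  induction k with
  | zero =>
    have hl : (l : ℕ) < 2 := by
      have := l.2
      simpa [serialNet, serialChan] using this
    have hi : (i : ℕ) < d := by
      have := i.2
      rw [← not_le, serialNet_len_le_iff] at this
      simpa using this
    rw [DCNN.hidden_succ, ConvWeights.affine_eq ((serialNet s d p L hs hn W₀ W).weights 0)
      (t := (serialNet s d p L hs hn W₀ W).stride 0) (N := 1) (t' := 1) (b := 0)
      (v := fun _ q => if h : q < d then y ⟨q, h⟩ else 0)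
      (fun c i => by
        have h : (i : ℕ) < d := i.2
        rw [dif_pos h]
        rfl) (l := l) (F := serialFilter s p W₀ W 0 l)
      (fun _ _ => rfl) rfl rfl rfl i, Finset.sum_range_one,
      Finset.sum_eq_single_of_mem 0 (Finset.mem_range.2 hs)
        (fun m _ hm => by simp [serialFilter, hm])]
    have hl2 : (l : ℕ) / 2 = 0 := by omega
    have hi' : (i : ℕ) < (serialNet s d p L hs hn W₀ W).len 0 := hi
    simp [serialFilter, signPart, hi, hi', hl2]
  | succ k ih =>
    have hpos : 0 < 2 * s ^ k := Nat.mul_pos two_pos (Nat.pow_pos hs)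
    have hc : (serialNet s d p L hs hn W₀ W).chan (k + 1) = 2 * s ^ k :=
      if_pos (by omega)
    have hl : (l : ℕ) < s * (2 * s ^ k) := by
      have := l.2
      have hc' : (serialNet s d p L hs hn W₀ W).chan (k + 1 + 1) = 2 * s ^ (k + 1) := if_pos hk
      calc (l : ℕ) < 2 * s ^ (k + 1) := hc' ▸ this
        _ = _ := by ring
    have hmod : (l : ℕ) % (2 * s ^ k) < 2 * s ^ k := Nat.mod_lt _ hpos
    have hdiv : (l : ℕ) / (2 * s ^ k) < s := Nat.div_lt_of_lt_mul (by rwa [mul_comm])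
    have hlm := Nat.div_add_mod' (l : ℕ) (2 * s ^ k)
    have hF : ∀ c ∈ Finset.range (2 * s ^ k), ∀ m, serialFilter s p W₀ W (k + 1) l c m =
        if c = (l : ℕ) % (2 * s ^ k) ∧ m = (l : ℕ) / (2 * s ^ k) then 1 else 0 := by
      intro c hcm m
      have hck := Finset.mem_range.1 hcm
      have : (l : ℕ) = m * (2 * s ^ k) + c ↔
          c = (l : ℕ) % (2 * s ^ k) ∧ m = (l : ℕ) / (2 * s ^ k) := by
        constructor
        · intro h
          rw [h, Nat.mul_add_mod', Nat.mod_eq_of_lt hck, add_comm, Nat.add_mul_div_right _ _ hpos,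
            Nat.div_eq_of_lt hck, zero_add]
          exact ⟨rfl, rfl⟩
        · rintro ⟨rfl, rfl⟩
          exact hlm.symm
      simp only [serialFilter, if_pos (show k < p by omega), this]
    rw [DCNN.hidden_succ, ConvWeights.affine_eq
      ((serialNet s d p L hs hn W₀ W).weights (k + 1))
      (t := (serialNet s d p L hs hn W₀ W).stride (k + 1)) (N := 2 * s ^ k) (t' := s) (b := 0)
      (v := fun c q => signPart y c (q * s ^ k + c / 2))
      (ih (by omega)) (l := l) (F := serialFilter s p W₀ W (k + 1) l)
      (fun _ _ => rfl) hc rfl rfl i, Finset.sum_eq_single_of_mem _ (Finset.mem_range.2 hmod),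
      Finset.sum_eq_single_of_mem _ (Finset.mem_range.2 hdiv)]
    · rw [hF _ (Finset.mem_range.2 hmod), if_pos ⟨rfl, rfl⟩, one_mul, add_zero]
      have h2 : ((i : ℕ) * s + (l : ℕ) / (2 * s ^ k)) * s ^ k + (l : ℕ) % (2 * s ^ k) / 2 =
          (i : ℕ) * s ^ (k + 1) + (l : ℕ) / 2 := by
        have : (l : ℕ) / 2 = (l : ℕ) / (2 * s ^ k) * s ^ k + (l : ℕ) % (2 * s ^ k) / 2 := by
          conv_lhs => rw [← hlm]
          rw [show (l : ℕ) / (2 * s ^ k) * (2 * s ^ k) + (l : ℕ) % (2 * s ^ k) =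
            2 * ((l : ℕ) / (2 * s ^ k) * s ^ k) + (l : ℕ) % (2 * s ^ k) by ring,
            Nat.mul_add_div two_pos]
        rw [this]
        ring
      have h3 : ((-1 : ℝ)) ^ ((l : ℕ) % (2 * s ^ k)) = (-1) ^ (l : ℕ) := by
        conv_rhs => rw [← hlm]
        rw [pow_add, mul_left_comm, pow_mul]
        simp
      have h4 : ∀ q, signPart y ((l : ℕ) % (2 * s ^ k)) q = signPart y l q := by
        intro q
        simp only [signPart, h3]
      rw [h2, h4]
      split_ifs with hlt
      · exact max_eq_left (signPart_nonneg _ _ _)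
      -- Zero padding beyond the end of a channel matches the value `0` of `signPart` outside the
      -- range of `y`.
      · rw [not_lt, serialNet_len_le_iff] at hlt
        rw [signPart_of_le, max_self]
        calc d ≤ s ^ k * ((i : ℕ) * s + (l : ℕ) / (2 * s ^ k)) := hlt
          _ ≤ ((i : ℕ) * s + (l : ℕ) / (2 * s ^ k)) * s ^ k + (l : ℕ) % (2 * s ^ k) / 2 := by
            rw [mul_comm]; exact Nat.le_add_right _ _
          _ = _ := h2
    · intro m _ hm
      rw [hF _ (Finset.mem_range.2 hmod), if_neg fun h => hm h.2, zero_mul]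
    · intro c hc' hne
      refine Finset.sum_eq_zero fun m _ => ?_
      rw [hF c hc', if_neg fun h => hne h.1, zero_mul]

theorem serialNet_len_recurrent (hd : 0 < d) (hp : d ≤ s ^ p) (k : ℕ) :
    (serialNet s d p L hs hn W₀ W).len (p + 1 + k) = 1 := by
  rw [add_right_comm]
  exact serialNet_len_eq_one hs hn W₀ W hd (hp.trans (Nat.pow_le_pow_right hs (by omega)))

theorem serialChan_recurrent (s p n k : ℕ) : serialChan s p n (p + 2 + k) = n := by
  rw [show p + 2 + k = (p + 1 + k) + 1 by ring]
  exact if_neg (by omega)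

theorem serialFilter_recurrent (k : ℕ) (a : Fin n) (c m : ℕ) :
    serialFilter s p W₀ W (p + 2 + k) a c m =
      if m = 0 then (if h : c < n then W a ⟨c, h⟩ else 0) else 0 := by
  rw [show p + 2 + k = (p + 1 + k) + 1 by ring]
  simp only [serialFilter]
  rw [if_neg (show ¬p + 1 + k < p by omega), dif_pos a.2, if_neg (show ¬p + 1 + k = p by omega)]

/-- With channels of length one, only the first tap meets the signal, so the layers are plain matrix
products. The offset `p + 2` counts the sign layer, the `p` serializing layers and the layer of
`W₀`. -/
theorem serialNet_hidden_recurrent (hd : 0 < d) (hp : d ≤ s ^ p) (y : Fin d → ℝ) (k : ℕ)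
    (l : Fin ((serialNet s d p L hs hn W₀ W).chan (p + 2 + k))) (i) (a : Fin n)
    (ha : (a : ℕ) = l) :
    (serialNet s d p L hs hn W₀ W).hidden y (p + 2 + k) l i = recurrentState s p W₀ W y k a := by
  have hlen := serialNet_len_recurrent (L := L) hs hn W₀ W hd hp
  have hlen' : ∀ k, (serialNet s d p L hs hn W₀ W).len (p + 2 + k) = 1 := fun k => by
    rw [show p + 2 + k = p + 1 + (k + 1) by ring, hlen]
  have hi : (i : ℕ) = 0 := by
    have := i.2
    have := hlen' k
    omega
  induction k generalizing a with
  | zero =>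
    have h := ConvWeights.affine_eq_of_forall_ne ((serialNet s d p L hs hn W₀ W).weights (p + 1))
      (t := (serialNet s d p L hs hn W₀ W).stride (p + 1))
      (N := 2 * s ^ p) (b := 0) hs (hlen 0) (x := (serialNet s d p L hs hn W₀ W).hidden y (p + 1))
      (v := fun c => signPart y c (c / 2))
      (fun c i => by
        rw [serialNet_hidden_serial hs hn W₀ W y le_rfl]
        have := i.2
        have := hlen 0
        rw [show (i : ℕ) = 0 by omega, zero_mul, zero_add]) (l := l)
      (g := fun c => W₀ a c)
      (fun c m => by simp [serialNet, serialFilter, ← ha]) (if_pos le_rfl) rfl i hi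
    refine (congrArg (fun u => max u 0) h).trans ?_
    simp only [add_zero]
    rfl
  | succ k ih =>
    have h := ConvWeights.affine_eq_of_forall_ne
      ((serialNet s d p L hs hn W₀ W).weights (p + 2 + k))
      (t := (serialNet s d p L hs hn W₀ W).stride (p + 2 + k))
      (N := n) (b := 0) hs (hlen' k) (x := (serialNet s d p L hs hn W₀ W).hidden y (p + 2 + k))
      (v := fun c => if h : c < n then recurrentState s p W₀ W y k ⟨c, h⟩ else 0)
      (fun c i => by
        have hc : (c : ℕ) < n := by
          have := c.2
          have hc' : (serialNet s d p L hs hn W₀ W).chan (p + 2 + k) = n :=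
            serialChan_recurrent s p n k
          omega
        have hi : (i : ℕ) = 0 := by
          have := i.2
          have := hlen' k
          omega
        rw [dif_pos hc]
        exact ih c i ⟨c, hc⟩ rfl hi) (l := l)
      (g := fun c => if h : c < n then W a ⟨c, h⟩ else 0)
      (fun c m => by
        change serialFilter s p W₀ W (p + 2 + k) l c m = _
        rw [← ha, serialFilter_recurrent])
      (serialChan_recurrent s p n k) rfl i hi
    rw [add_zero, ← Fin.sum_univ_eq_sum_range (fun c => (if h : c < n then W a ⟨c, h⟩ else 0) *
      (if h : c < n then recurrentState s p W₀ W y k ⟨c, h⟩ else 0))] at h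
    refine (congrArg (fun u => max u 0) h).trans ?_
    simp [recurrentState]

end SerialNet

section SerialCNN

variable {s J : ℕ} {d : Fin (J + 1) → ℕ} {p n K : ℕ} (hs : 0 < s) (hn : 0 < n) (hd : 0 < d 0)
  (hp : d 0 ≤ s ^ p) (W₀ : Fin n → ℕ → ℝ) (W : Fin n → Fin n → ℝ)
  (V : ∀ j : Fin J, Fin (d j.succ) → Fin n → ℝ) (β : ∀ j : Fin J, Fin (d j.succ) → ℝ)

/-- The network `serialNet` with output layers that apply the matrix `V j` and the bias `β j` to
the state after `K + j` steps. -/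
noncomputable def serialCNN (K : ℕ) : DeepCodingCNN s J d where
  net := serialNet s (d 0) p (p + 2 + K + J) hs hn W₀ W
  -- The extra `j` steps only make the taps strictly increasing.
  tap j := p + 2 + (K + j)
  tap_le j := by
    change _ ≤ p + 2 + K + J
    omega
  tap_strictMono j j' h := by
    have : (j : ℕ) < j' := h
    change p + 2 + (K + (j : ℕ)) < p + 2 + (K + (j' : ℕ))
    omega
  outStride _ := 1
  outStride_pos _ := le_rfl
  outLen j := by
    rw [show p + 2 + (K + (j : ℕ)) = p + 1 + (K + j + 1) by ring,
      serialNet_len_recurrent hs hn W₀ W hd hp]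
    simp
  outWeights j :=
    ⟨fun i c m => if (m : ℕ) = 0 then (if h : (c : ℕ) < n then V j i ⟨c, h⟩ else 0) else 0, β j⟩

theorem serialCNN_output (y : Fin (d 0) → ℝ) (j : Fin J) (i : Fin (d j.succ)) :
    (serialCNN hs hn hd hp W₀ W V β K).output y j i =
      (∑ a, V j i a * recurrentState s p W₀ W y (K + j) a) + β j i := by
  have hlen : (serialCNN hs hn hd hp W₀ W V β K).net.len
      ((serialCNN hs hn hd hp W₀ W V β K).tap j) = 1 := by
    change (serialNet s (d 0) p (p + 2 + K + J) hs hn W₀ W).len (p + 2 + (K + j)) = 1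
    rw [show p + 2 + (K + (j : ℕ)) = p + 1 + (K + j + 1) by ring]
    exact serialNet_len_recurrent hs hn W₀ W hd hp _
  have hc : (serialCNN hs hn hd hp W₀ W V β K).net.chan
      ((serialCNN hs hn hd hp W₀ W V β K).tap j) = n := serialChan_recurrent s p n _
  unfold DeepCodingCNN.output
  rw [((serialCNN hs hn hd hp W₀ W V β K).outWeights j).affine_eq_of_forall_ne hs hlen
    (v := fun c => if h : c < n then recurrentState s p W₀ W y (K + j) ⟨c, h⟩ else 0)
    (fun c i => by
      have h : (c : ℕ) < n := by have := c.2; omega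
      rw [dif_pos h]
      exact serialNet_hidden_recurrent hs hn W₀ W hd hp y (K + j) c i ⟨c, h⟩ rfl)
    (g := fun c => if h : c < n then V j i ⟨c, h⟩ else 0) (fun _ _ => rfl) hc rfl _ rfl,
    ← Fin.sum_univ_eq_sum_range (fun c => (if h : c < n then V j i ⟨c, h⟩ else 0) *
      (if h : c < n then recurrentState s p W₀ W y (K + j) ⟨c, h⟩ else 0))]
  simp [serialCNN]

theorem serialCNN_numWeights : (serialCNN hs hn hd hp W₀ W V β K).numWeights =
    (2 * s + 2) + (∑ k ∈ Finset.range p, (2 * s ^ (k + 1) * (2 * s ^ k) * s + 2 * s ^ (k + 1))) +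
      (n * (2 * s ^ p) * s + n) + (K + J) * (n * n * s + n) +
      ∑ j : Fin J, (d j.succ * n * s + d j.succ) := by
  have hc : ∀ k, serialChan s p n (p + 2 + k) = n := serialChan_recurrent s p n
  have hc' : ∀ k, k ≤ p → serialChan s p n (k + 1) = 2 * s ^ k := fun k hk => if_pos hk
  change (∑ k ∈ Finset.range (p + 2 + K + J), (serialChan s p n (k + 1) * serialChan s p n k * s +
    serialChan s p n (k + 1))) + ∑ j : Fin J, (d j.succ * serialChan s p n (p + 2 + (K + j)) * s +
      d j.succ) = _
  congr 1
  · rw [add_assoc (p + 2), Finset.sum_range_add, Finset.sum_range_succ, Finset.sum_range_succ']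
    congr 1
    · congr 1
      · rw [add_comm]
        refine congrArg₂ _ ?_ (Finset.sum_congr rfl fun k hk => ?_)
        · change serialChan s p n (0 + 1) * 1 * s + serialChan s p n (0 + 1) = _
          rw [hc' 0 (Nat.zero_le p), pow_zero, mul_one, mul_one]
        · have := Finset.mem_range.1 hk
          rw [hc' (k + 1) (by omega), hc' k (by omega)]
      · rw [hc' p le_rfl, hc 0]
    · rw [Finset.sum_congr rfl fun k _ => by rw [add_assoc (p + 2) k 1, hc, hc]]
      simp
  · exact Finset.sum_congr rfl fun j _ => by rw [hc]

end SerialCNN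

/-! ### Counting layers and weights -/

theorem Finset.two_pow_card_le_prod {ι : Type*} (t : Finset ι) {a : ι → ℕ} (ha : ∀ j, 2 ≤ a j) :
    2 ^ t.card ≤ ∏ j ∈ t, a j :=
  Finset.pow_card_le_prod _ _ _ fun j _ => ha j

/-- Equality holds when every factor is `2`. The factor `2 ^ t.card` is kept because it later
outweighs polynomial factors in the number of terms. -/
theorem Finset.sum_mul_two_pow_le {ι : Type*} (t : Finset ι) {a : ι → ℕ} (ha : ∀ j, 2 ≤ a j) :
    (∑ j ∈ t, a j) * 2 ^ t.card ≤ 2 * t.card * ∏ j ∈ t, a j := by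
  classical
  induction t using Finset.induction_on with
  | empty => simp
  | insert i t hi ih =>
    rw [Finset.sum_insert hi, Finset.prod_insert hi, Finset.card_insert_of_notMem hi]
    have h1 := Nat.mul_le_mul_left (2 * a i) (t.two_pow_card_le_prod ha)
    have h2 := Nat.mul_le_mul_right (2 * t.card * ∏ j ∈ t, a j) (ha i)
    calc (a i + ∑ j ∈ t, a j) * 2 ^ (t.card + 1)
        = 2 * a i * 2 ^ t.card + 2 * ((∑ j ∈ t, a j) * 2 ^ t.card) := by ring
      _ ≤ 2 * a i * ∏ j ∈ t, a j + a i * (2 * t.card * ∏ j ∈ t, a j) := by omega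
      _ = _ := by ring

theorem succ_mul_sq_le_two_mul_four_pow (J : ℕ) : (J + 1) * J ^ 2 ≤ 2 * 4 ^ J := by
  rcases Nat.lt_or_ge J 2 with h | h
  -- The induction step needs `(J + 2) * (J + 1) ≤ 4 * J ^ 2`, which fails for `J = 1`.
  · interval_cases J <;> norm_num
  induction J, h using Nat.le_induction with
  | base => norm_num
  | succ J hJ ih =>
    obtain ⟨m, rfl⟩ := Nat.exists_eq_add_of_le' hJ
    have h : (m + 4) * (m + 3) ≤ 4 * (m + 2) ^ 2 := by nlinarith
    calc (m + 2 + 1 + 1) * (m + 2 + 1) ^ 2 = (m + 4) * (m + 3) * (m + 3) := by ring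
      _ ≤ 4 * (m + 2) ^ 2 * (m + 3) := Nat.mul_le_mul_right _ h
      _ = 4 * ((m + 2 + 1) * (m + 2) ^ 2) := by ring
      _ ≤ 4 * (2 * 4 ^ (m + 2)) := Nat.mul_le_mul_left _ ih
      _ = _ := by ring

/-- The left side is the cost of the recurrent part per unit of `K`: up to `J + 1` layers with a
number of weights quadratic in the total dimension. -/
theorem succ_card_mul_sum_sq_le {J : ℕ} {a : Fin J → ℕ} (ha : ∀ j, 2 ≤ a j) :
    (J + 1) * (∑ j, a j) ^ 2 ≤ 8 * (∏ j, a j) ^ 2 := by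
  have h1 := Finset.univ.sum_mul_two_pow_le ha
  rw [Finset.card_univ, Fintype.card_fin] at h1
  refine Nat.le_of_mul_le_mul_right (c := 4 ^ J) ?_ (by positivity)
  calc (J + 1) * (∑ j, a j) ^ 2 * 4 ^ J = (J + 1) * ((∑ j, a j) * 2 ^ J) ^ 2 := by
        rw [mul_pow, ← pow_mul, mul_comm J 2, pow_mul]; ring
    _ ≤ (J + 1) * (2 * J * ∏ j, a j) ^ 2 := by gcongr
    _ = 4 * (∏ j, a j) ^ 2 * ((J + 1) * J ^ 2) := by ring
    _ ≤ 4 * (∏ j, a j) ^ 2 * (2 * 4 ^ J) :=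
        Nat.mul_le_mul_left _ (succ_mul_sq_le_two_mul_four_pow J)
    _ = _ := by ring

theorem sum_le_prod_of_two_le {J : ℕ} {a : Fin J → ℕ} (ha : ∀ j, 2 ≤ a j) :
    ∑ j, a j ≤ ∏ j, a j := by
  have h1 := Finset.univ.sum_mul_two_pow_le ha
  rw [Finset.card_univ, Fintype.card_fin] at h1
  have h2 : 2 * J ≤ 2 ^ J := by
    cases J with
    | zero => simp
    | succ J =>
      have := Nat.lt_two_pow_self (n := J)
      rw [pow_succ]
      omega
  exact Nat.le_of_mul_le_mul_right (c := 2 ^ J) (h1.trans (by rw [mul_comm]; gcongr))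
    (by positivity)

theorem sum_range_pow_succ_le {q : ℕ} (hq : 2 ≤ q) (p : ℕ) :
    ∑ k ∈ Finset.range p, q ^ (k + 1) ≤ 2 * q ^ p := by
  induction p with
  | zero => simp
  | succ p ih =>
    rw [Finset.sum_range_succ]
    have := Nat.mul_le_mul_right (q ^ p) hq
    rw [pow_succ]
    linarith

theorem pow_clog_le_mul {s d : ℕ} (hs : 2 ≤ s) (hd : 1 ≤ d) : s ^ Nat.clog s d ≤ s * d := by
  rcases hd.eq_or_lt with rfl | h
  · simp; omega
  · have h1 := Nat.pow_pred_clog_lt_self hs h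
    have h2 := Nat.clog_pos hs h
    calc s ^ Nat.clog s d = s * s ^ (Nat.clog s d).pred := by
          rw [← pow_succ', ← Nat.succ_eq_add_one, Nat.succ_pred_eq_of_pos h2]
      _ ≤ s * d := Nat.mul_le_mul_left _ h1.le

section Counting

variable {J : ℕ} {d : Fin (J + 1) → ℕ}

theorem sum_le_sum_add (hJ : 1 ≤ J) : ∑ j, d j ≤ ∑ j : Fin J, (d j.castSucc + d j.succ) := by
  obtain ⟨J, rfl⟩ := Nat.exists_eq_add_of_le' hJ
  rw [Fin.sum_univ_succ, Finset.sum_add_distrib]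
  gcongr
  exact Finset.single_le_sum (f := fun j : Fin (J + 1) => d j.castSucc) (fun _ _ => Nat.zero_le _)
    (Finset.mem_univ 0)

/-- The five summands contribute `4 + 12 + 9 + 144 + 6 = 175`. The serializing layers form a
geometric sum of ratio `s ^ 2`, dominated by its last term. -/
theorem weights_count_le (hJ : 1 ≤ J) (hd : ∀ j, 1 ≤ d j) {s K n p : ℕ} (hs : 2 ≤ s) (hK : 1 ≤ K)
    (hn : n = 2 * (∑ j, d j) + 1) (hp : s ^ p ≤ s * d 0) :
    (2 * s + 2) + (∑ k ∈ Finset.range p, (2 * s ^ (k + 1) * (2 * s ^ k) * s + 2 * s ^ (k + 1))) +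
      (n * (2 * s ^ p) * s + n) + (K + J) * (n * n * s + n) +
      ∑ j : Fin J, (d j.succ * n * s + d j.succ) ≤
      175 * s ^ 2 * (K * (∏ j : Fin J, (d j.castSucc + d j.succ)) ^ 2) := by
  have ha : ∀ j : Fin J, 2 ≤ d j.castSucc + d j.succ := fun j =>
    Nat.add_le_add (hd _) (hd _)
  have hSP := sum_le_prod_of_two_le ha
  have hJS := succ_card_mul_sum_sq_le ha
  have hdS := sum_le_sum_add (d := d) hJ
  have hd0 : d 0 ≤ ∑ j, d j := Finset.single_le_sum (fun _ _ => Nat.zero_le _) (Finset.mem_univ 0)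
  have hsucc : ∑ j : Fin J, d j.succ ≤ ∑ j, d j := by
    rw [Fin.sum_univ_succ (f := d)]
    omega
  have hd1 := hd 0
  have hout : ∑ j : Fin J, (d j.succ * n * s + d j.succ) = (∑ j : Fin J, d j.succ) * (n * s + 1) := by
    rw [Finset.sum_mul]
    exact Finset.sum_congr rfl fun j _ => by ring
  rw [hout]
  generalize ∏ j : Fin J, (d j.castSucc + d j.succ) = P at *
  generalize ∑ j : Fin J, (d j.castSucc + d j.succ) = S at *
  generalize ∑ j : Fin J, d j.succ = S' at *
  have hS1 : 1 ≤ S := by omega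
  have hn3 : n ≤ 3 * S := by omega
  have hS'S : S' ≤ S := by omega
  have hd0P : d 0 ≤ P := by omega
  have hP : 1 ≤ P := by omega
  have hPP : 1 ≤ P ^ 2 := Nat.one_le_pow _ _ hP
  have hss : s ≤ s ^ 2 := Nat.le_self_pow two_ne_zero s
  have hpP : s ^ p ≤ s * P := hp.trans (Nat.mul_le_mul_left _ hd0P)
  have hKP : P ^ 2 ≤ K * P ^ 2 := Nat.le_mul_of_pos_left _ hK
  have e1 : 2 * s + 2 ≤ 4 * s ^ 2 * (K * P ^ 2) :=
    calc 2 * s + 2 ≤ 4 * s ^ 2 * 1 := by omega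
      _ ≤ 4 * s ^ 2 * (K * P ^ 2) := Nat.mul_le_mul_left _ (hPP.trans hKP)
  have e2 : ∑ k ∈ Finset.range p, (2 * s ^ (k + 1) * (2 * s ^ k) * s + 2 * s ^ (k + 1)) ≤
      12 * s ^ 2 * (K * P ^ 2) :=
    calc _ ≤ ∑ k ∈ Finset.range p, 6 * (s ^ 2) ^ (k + 1) := Finset.sum_le_sum fun k _ => by
            have h1 : s ^ (k + 1) ≤ (s ^ 2) ^ (k + 1) := Nat.pow_le_pow_left hss _
            have h2 : 2 * s ^ (k + 1) * (2 * s ^ k) * s = 4 * (s ^ 2) ^ (k + 1) := by ring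
            omega
      _ = 6 * ∑ k ∈ Finset.range p, (s ^ 2) ^ (k + 1) := by rw [Finset.mul_sum]
      _ ≤ 6 * (2 * (s ^ 2) ^ p) :=
          Nat.mul_le_mul_left _ (sum_range_pow_succ_le (hs.trans hss) p)
      _ = 12 * (s ^ p) ^ 2 := by rw [← pow_mul, ← pow_mul, mul_comm 2 p]; ring
      _ ≤ 12 * (s * P) ^ 2 := by gcongr
      _ = 12 * s ^ 2 * P ^ 2 := by ring
      _ ≤ 12 * s ^ 2 * (K * P ^ 2) := Nat.mul_le_mul_left _ hKP
  have hns : 1 ≤ s ^ p * s := Nat.mul_pos (Nat.pow_pos (by omega)) (by omega)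
  have e3 : n * (2 * s ^ p) * s + n ≤ 9 * s ^ 2 * (K * P ^ 2) :=
    calc n * (2 * s ^ p) * s + n = n * (2 * (s ^ p * s) + 1) := by ring
      _ ≤ n * (3 * (s ^ p * s)) := Nat.mul_le_mul_left _ (by omega)
      _ ≤ (3 * P) * (3 * (s * P * s)) := by gcongr; omega
      _ = 9 * s ^ 2 * P ^ 2 := by ring
      _ ≤ _ := Nat.mul_le_mul_left _ hKP
  have e4 : (K + J) * (n * n * s + n) ≤ 144 * s ^ 2 * (K * P ^ 2) :=
    calc (K + J) * (n * n * s + n) ≤ (K * (J + 1)) * (2 * (n * n * s)) := by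
          refine Nat.mul_le_mul ?_ ?_
          · rw [mul_add, mul_one, add_comm]
            exact Nat.add_le_add_right (Nat.le_mul_of_pos_left _ hK) _
          · have : n * 1 ≤ n * (n * s) :=
              Nat.mul_le_mul_left _ (Nat.mul_pos (by omega) (by omega))
            rw [← mul_assoc] at this
            omega
      _ ≤ (K * (J + 1)) * (2 * (3 * S * (3 * S) * s)) := by gcongr
      _ = 18 * s * K * ((J + 1) * S ^ 2) := by ring
      _ ≤ 18 * s * K * (8 * P ^ 2) := Nat.mul_le_mul_left _ hJS
      _ = 144 * s * (K * P ^ 2) := by ring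
      _ ≤ _ := by gcongr
  have e5 : S' * (n * s + 1) ≤ 6 * s ^ 2 * (K * P ^ 2) :=
    calc S' * (n * s + 1) ≤ P * (2 * (n * s)) := by
          have : 1 ≤ n * s := Nat.mul_pos (by omega) (by omega)
          exact Nat.mul_le_mul (by omega) (by omega)
      _ ≤ P * (2 * (3 * P * s)) := by gcongr; omega
      _ = 6 * s * P ^ 2 := by ring
      _ ≤ 6 * s ^ 2 * (K * P ^ 2) := by gcongr
  linarith

/-- For large `s` the logarithm `L` to base `s` can be below one. But `2 ^ J ≤ P` and `log s ≤ s *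
log 2` give `1 ≤ J ≤ s * L`, so each of `L`, `J`, `K` and the constant `4` is bounded in terms of `K
* s * L`. -/
theorem depth_le (hJ : 1 ≤ J) (hd : ∀ j, 1 ≤ d j) {s K p : ℕ} (hs : 2 ≤ s) (hK : 1 ≤ K)
    (hp : s ^ p ≤ s * d 0) :
    ((p + 2 + K + J + 1 : ℕ) : ℝ) ≤
      7 * s * (K * Real.logb s (∏ j : Fin J, ((d j.castSucc : ℝ) + d j.succ))) := by
  have ha : ∀ j : Fin J, 2 ≤ d j.castSucc + d j.succ := fun j =>
    Nat.add_le_add (hd _) (hd _)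
  have h2P := Finset.univ.two_pow_card_le_prod ha
  have hd0 : d 0 ≤ ∑ j, d j := Finset.single_le_sum (fun _ _ => Nat.zero_le _) (Finset.mem_univ 0)
  have hdP : d 0 ≤ ∏ j : Fin J, (d j.castSucc + d j.succ) :=
    hd0.trans ((sum_le_sum_add hJ).trans (sum_le_prod_of_two_le ha))
  have hcast : ∏ j : Fin J, ((d j.castSucc : ℝ) + d j.succ) =
    ((∏ j : Fin J, (d j.castSucc + d j.succ) : ℕ) : ℝ) := by push_cast; rfl
  rw [hcast]
  rw [Finset.card_univ, Fintype.card_fin] at h2P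
  have hP0 := Nat.lt_of_lt_of_le (hd 0) hdP
  generalize ∏ j : Fin J, (d j.castSucc + d j.succ) = P at *
  have hs2 : (2 : ℝ) ≤ s := by exact_mod_cast hs
  have hls : 0 < Real.log s := Real.log_pos (by linarith)
  have hl2 : 0 < Real.log 2 := Real.log_pos one_lt_two
  have hP1 : (1 : ℝ) ≤ P := by exact_mod_cast hP0
  set L := Real.logb s P with hL
  have hLs : L * Real.log s = Real.log P := div_mul_cancel₀ _ hls.ne'
  have hL0 : 0 ≤ L := div_nonneg (Real.log_nonneg hP1) hls.le
  have h1 : (p : ℝ) ≤ 1 + L := by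
    have h : ((s : ℝ) ^ p) ≤ s * P := by exact_mod_cast hp.trans (Nat.mul_le_mul_left _ hdP)
    have h' := Real.log_le_log (by positivity) h
    rw [Real.log_pow, Real.log_mul (by positivity) (by positivity), ← hLs] at h'
    exact le_of_mul_le_mul_right (by linarith) hls
  have h2 : (J : ℝ) ≤ s * L := by
    have h : ((2 : ℝ) ^ J) ≤ P := by exact_mod_cast h2P
    have h' := Real.log_le_log (by positivity) h
    rw [Real.log_pow, ← hLs] at h'
    have h3 : (s : ℝ) ≤ 2 ^ s := by exact_mod_cast Nat.lt_two_pow_self.le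
    have h4 := Real.log_le_log (by linarith) h3
    rw [Real.log_pow] at h4
    have h5 := mul_le_mul_of_nonneg_left h4 hL0
    exact le_of_mul_le_mul_right (by linarith) hl2
  have h3 : (1 : ℝ) ≤ s * L := le_trans (by exact_mod_cast hJ) h2
  have hK1 : (1 : ℝ) ≤ K := by exact_mod_cast hK
  have h4 : L ≤ s * L := le_mul_of_one_le_left hL0 (by linarith)
  have h5 : (K : ℝ) ≤ K * (s * L) := le_mul_of_one_le_right (by linarith) h3
  have h6 : s * L ≤ K * (s * L) := le_mul_of_one_le_left (by linarith) hK1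
  push_cast
  linarith

end Counting

/-! ### Simultaneous iterative thresholding for all dictionaries -/

section DeepIteration

variable {J : ℕ} {d : Fin (J + 1) → ℕ}

theorem IsDeepSparseCoding.eq_mulVec {D : ∀ j : Fin J, Matrix (Fin (d j.castSucc)) (Fin (d j.succ)) ℝ}
    {lam : Fin J → ℝ≥0} {x : ∀ j : Fin (J + 1), Fin (d j) → ℝ}
    (hx : IsDeepSparseCoding D lam 0 x) (j : Fin J) : x j.castSucc = (D j).mulVec (x j.succ) := by
  have h := (hx j).1
  simp only [Pi.zero_apply, NNReal.coe_zero, l2norm, norm_le_zero_iff, WithLp.toLp_eq_zero] at h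
  exact sub_eq_zero.1 h

/-- The gradient steps for `z 1, …, z J` with the observations `z 0, …, z (J - 1)`; the vector `z 0`
is kept. -/
noncomputable def deepGradientStep
    (D : ∀ j : Fin J, Matrix (Fin (d j.castSucc)) (Fin (d j.succ)) ℝ)
    (z : ∀ j : Fin (J + 1), Fin (d j) → ℝ) : ∀ j : Fin (J + 1), Fin (d j) → ℝ :=
  Fin.cases (z 0) fun j => z j.succ +
    (D j).transpose.mulVec (z j.castSucc - (D j).mulVec (z j.succ))

/-- Keeping the observation `z 0` in the state makes the step linear rather than affine, so it
becomes a fixed matrix without biases. -/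
theorem deepGradientStep_add
    (D : ∀ j : Fin J, Matrix (Fin (d j.castSucc)) (Fin (d j.succ)) ℝ)
    (z w : ∀ j : Fin (J + 1), Fin (d j) → ℝ) :
    deepGradientStep D (z + w) = deepGradientStep D z + deepGradientStep D w := by
  funext j
  induction j using Fin.cases with
  | zero => rfl
  | succ j =>
    simp only [deepGradientStep, Pi.add_apply, Fin.cases_succ, Matrix.mulVec_add,
      Matrix.mulVec_sub]
    abel

theorem deepGradientStep_smul
    (D : ∀ j : Fin J, Matrix (Fin (d j.castSucc)) (Fin (d j.succ)) ℝ) (a : ℝ)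
    (z : ∀ j : Fin (J + 1), Fin (d j) → ℝ) :
    deepGradientStep D (a • z) = a • deepGradientStep D z := by
  funext j
  induction j using Fin.cases with
  | zero => rfl
  | succ j =>
    simp only [deepGradientStep, Pi.smul_apply, Fin.cases_succ, Matrix.mulVec_smul,
      Matrix.mulVec_sub, smul_add, smul_sub]

/-- The gradient steps, followed by soft thresholding with the thresholds `κ j * τ`. -/
noncomputable def deepThresholdStep
    (D : ∀ j : Fin J, Matrix (Fin (d j.castSucc)) (Fin (d j.succ)) ℝ) (κ : Fin (J + 1) → ℝ) (τ : ℝ)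
    (z : ∀ j : Fin (J + 1), Fin (d j) → ℝ) : ∀ j : Fin (J + 1), Fin (d j) → ℝ :=
  fun j i => softThreshold (κ j * τ) (deepGradientStep D z j i)

/-- The factors of the thresholds: `0` for the observation, which is kept, and
`μ(D_j) Q ^ j + Q ^ (j - 1)` for `z j`. -/
noncomputable def thresholdFactor
    (D : ∀ j : Fin J, Matrix (Fin (d j.castSucc)) (Fin (d j.succ)) ℝ) (Q : ℝ) : Fin (J + 1) → ℝ :=
  Fin.cases 0 fun j => mutualCoherence (D j) * Q ^ (j.succ : ℕ) + Q ^ (j.castSucc : ℕ)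

/-- The vectors `z j` approximate the codes `x j`, have no false support, and `z 0` is exact. -/
structure IsCodeApprox (x z : ∀ j : Fin (J + 1), Fin (d j) → ℝ) (Q τ : ℝ) : Prop where
  zero : z 0 = x 0
  support : ∀ j i, x j i = 0 → z j i = 0
  error : ∀ j : Fin (J + 1), l1norm (x j - z j) ≤ Q ^ (j : ℕ) * τ

variable {D : ∀ j : Fin J, Matrix (Fin (d j.castSucc)) (Fin (d j.succ)) ℝ}
  {x z : ∀ j : Fin (J + 1), Fin (d j) → ℝ} {Q r ρ τ : ℝ}

theorem deepThresholdStep_succ (j : Fin J) :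
    deepThresholdStep D (thresholdFactor D Q) τ z j.succ =
      thresholdStep (D j)
        (mutualCoherence (D j) * (Q ^ (j.succ : ℕ) * τ) + Q ^ (j.castSucc : ℕ) * τ)
        (z j.castSucc) (z j.succ) := by
  funext i
  simp only [deepThresholdStep, thresholdStep, thresholdFactor, deepGradientStep, Fin.cases_succ]
  congr 1
  ring

/-- The noise at level `j` is the error `Q ^ (j - 1) * τ` one level up. It costs `2 * d_j * Q ^ (j -
1) * τ ≤ (ρ - r) * Q ^ j * τ`, just the gap between the contraction factor `r` and `ρ`. -/
theorem IsCodeApprox.step (hD : ∀ j, ColumnNormalized (D j))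
    (hx : ∀ j, x j.castSucc = (D j).mulVec (x j.succ)) (hr : 0 ≤ r) (hρ : 0 ≤ ρ)
    (hxr : ∀ j : Fin J, (2 * (l0norm (x j.succ) : ℝ) - 1) * mutualCoherence (D j) ≤ r)
    (hQ : 0 ≤ Q) (hτ : 0 ≤ τ) (hQd : ∀ j : Fin J, 2 * (d j.succ : ℝ) ≤ (ρ - r) * Q)
    (h : IsCodeApprox x z Q τ) :
    IsCodeApprox x (deepThresholdStep D (thresholdFactor D Q) τ z) Q (ρ * τ) := by
  have h0 : deepThresholdStep D (thresholdFactor D Q) τ z 0 = x 0 := by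
    funext i
    simp only [deepThresholdStep, thresholdFactor, deepGradientStep, Fin.cases_zero, zero_mul,
      softThreshold_zero, h.zero]
  have hu : ∀ j : Fin J, l1norm (z j.castSucc - (D j).mulVec (x j.succ)) ≤
      Q ^ (j.castSucc : ℕ) * τ := fun j => by
    rw [← hx, l1norm_sub_comm]
    exact h.error _
  refine ⟨h0, fun j => ?_, fun j => ?_⟩
  · induction j using Fin.cases with
    | zero => intro i hi; rw [h0, hi]
    | succ j =>
      intro i hi
      rw [deepThresholdStep_succ]
      exact (hD j).thresholdStep_eq_zero (hu j) (h.error j.succ) hi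
  · induction j using Fin.cases with
    | zero =>
      rw [h0, sub_self]
      simpa [l1norm] using mul_nonneg hρ hτ
    | succ j =>
      rw [deepThresholdStep_succ]
      refine ((hD j).l1norm_sub_thresholdStep_le (hu j) (h.error j.succ) (h.support j.succ) hr
        (hxr j)).trans ?_
      have h1 := mul_le_mul_of_nonneg_right (hQd j)
        (mul_nonneg (pow_nonneg hQ (j.castSucc : ℕ)) hτ)
      have h2 : Q ^ (j.succ : ℕ) = Q * Q ^ (j.castSucc : ℕ) := by
        rw [Fin.val_succ, Fin.val_castSucc, pow_succ']
      rw [h2]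
      linarith

theorem l1norm_le_pow_mul (hD : ∀ j, ColumnNormalized (D j))
    (hx : ∀ j, x j.castSucc = (D j).mulVec (x j.succ)) (hρ : ρ ≤ 1) (hr : r < 1)
    (hxr : ∀ j : Fin J, (2 * (l0norm (x j.succ) : ℝ) - 1) * mutualCoherence (D j) ≤ r)
    (hQ : 0 ≤ Q) (hQd : ∀ j : Fin J, 2 * (d j.succ : ℝ) ≤ (ρ - r) * Q) (j : Fin (J + 1)) :
    l1norm (x j) ≤ Q ^ (j : ℕ) * l1norm (x 0) := by
  induction j using Fin.induction with
  | zero => simp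
  | succ j ih =>
    have h1 := (hD j).mul_l1norm_le (hxr j)
    rw [← hx] at h1
    have h0 := l1norm_nonneg (x j.castSucc)
    have h2 := mul_le_mul_of_nonneg_right (hQd j) h0
    have h3 : (ρ - r) * Q ≤ (1 - r) * Q := mul_le_mul_of_nonneg_right (by linarith) hQ
    have h4 := mul_le_mul_of_nonneg_right h3 h0
    have h5 : 0 ≤ (d j.succ : ℝ) * l1norm (x j.castSucc) := by positivity
    have h6 : l1norm (x j.succ) ≤ Q * l1norm (x j.castSucc) :=
      le_of_mul_le_mul_left (by linarith) (sub_pos.2 hr)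
    refine h6.trans ((mul_le_mul_of_nonneg_left ih hQ).trans_eq ?_)
    rw [Fin.val_succ, Fin.val_castSucc, pow_succ']
    ring

/-- This turns error bounds in terms of `‖x 0‖₁` into errors relative to `‖x j‖₁`. -/
theorem l1norm_zero_le_pow_mul (hD : ∀ j, ColumnNormalized (D j))
    (hx : ∀ j, x j.castSucc = (D j).mulVec (x j.succ)) {R : ℝ} (hR : ∀ j, (d j : ℝ) ≤ R)
    (j : Fin (J + 1)) : l1norm (x 0) ≤ R ^ (j : ℕ) * l1norm (x j) := by
  have hR0 : 0 ≤ R := (Nat.cast_nonneg _).trans (hR 0)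
  induction j using Fin.induction with
  | zero => simp
  | succ j ih =>
    have h1 := (hD j).l1norm_mulVec_le (x j.succ)
    rw [← hx] at h1
    have h2 := h1.trans (mul_le_mul_of_nonneg_right (hR j.castSucc) (l1norm_nonneg _))
    refine ih.trans ((mul_le_mul_of_nonneg_left h2 (pow_nonneg hR0 _)).trans_eq ?_)
    rw [Fin.val_succ, Fin.val_castSucc, pow_succ]
    ring

theorem exists_coherence_bound {lam : Fin J → ℝ≥0} (h : ∀ j, UniquenessCondition (D j) (lam j)) :
    ∃ r : ℝ, 0 ≤ r ∧ r < 1 ∧ ∀ j, (2 * (lam j : ℝ) - 1) * mutualCoherence (D j) ≤ r := by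
  -- The value `0` at `none` makes the maximum nonnegative.
  obtain ⟨o, ho⟩ := Finite.exists_max fun o : Option (Fin J) =>
    o.elim (0 : ℝ) fun j => (2 * (lam j : ℝ) - 1) * mutualCoherence (D j)
  refine ⟨_, ho none, ?_, fun j => ho (some j)⟩
  cases o with
  | none => exact one_pos
  | some j => exact (h j).mul_lt_one

end DeepIteration

/-! ### The iteration as a recurrent network -/

section CodingState

variable {J : ℕ} {d : Fin (J + 1) → ℕ}

/-- The channels of the recurrent network: positive and negative parts of the entries of
`z 0, …, z J`, and the threshold. -/
abbrev CodingIndex (d : Fin (J + 1) → ℕ) : Type := (Bool × (Σ j, Fin (d j))) ⊕ Unit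

theorem card_codingIndex : Fintype.card (CodingIndex d) = 2 * (∑ j, d j) + 1 := by
  simp

/-- The vectors that are represented by their positive and negative parts. -/
def codingValue (v : CodingIndex d → ℝ) : ∀ j, Fin (d j) → ℝ :=
  fun j i => v (.inl (true, ⟨j, i⟩)) - v (.inl (false, ⟨j, i⟩))

/-- The linear part of a layer of the recurrent network. -/
noncomputable def codingStep (D : ∀ j : Fin J, Matrix (Fin (d j.castSucc)) (Fin (d j.succ)) ℝ)
    (κ : Fin (J + 1) → ℝ) (ρ : ℝ) : (CodingIndex d → ℝ) →ₗ[ℝ] (CodingIndex d → ℝ) where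
  toFun v := Sum.elim (fun a => cond a.1 1 (-1) * deepGradientStep D (codingValue v) a.2.1 a.2.2 -
    κ a.2.1 * v (.inr ())) fun _ => ρ * v (.inr ())
  map_add' v w := by
    have h : codingValue (v + w) = codingValue v + codingValue w := by
      funext j i
      simp only [codingValue, Pi.add_apply]
      ring
    rw [h, deepGradientStep_add]
    funext a
    rcases a with a | a <;> simp only [Sum.elim_inl, Sum.elim_inr, Pi.add_apply] <;> ring
  map_smul' c v := by
    have h : codingValue (c • v) = c • codingValue v := by
      funext j i
      simp only [codingValue, Pi.smul_apply, smul_eq_mul]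
      ring
    rw [h, deepGradientStep_smul]
    funext a
    rcases a with a | a <;>
      simp only [Sum.elim_inl, Sum.elim_inr, Pi.smul_apply, smul_eq_mul, RingHom.id_apply] <;> ring

/-- The weights of the layer that computes the initial state from the positive and negative parts
of the entries of the input. -/
def codingInit : CodingIndex d → ℕ → ℝ
  | .inl (b, ⟨j, i⟩), c => if j = 0 ∧ c = 2 * (i : ℕ) + cond b 0 1 then 1 else 0
  | .inr _, _ => 1

/-- The states of the recurrent network, see `recurrentState`. -/
noncomputable def codingState (D : ∀ j : Fin J, Matrix (Fin (d j.castSucc)) (Fin (d j.succ)) ℝ)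
    (κ : Fin (J + 1) → ℝ) (ρ : ℝ) (N : ℕ) (y : Fin (d 0) → ℝ) : ℕ → CodingIndex d → ℝ
  | 0 => fun a => max (∑ c ∈ Finset.range (2 * N), codingInit a c * signPart y c (c / 2)) 0
  | k + 1 => fun a => max (codingStep D κ ρ (codingState D κ ρ N y k) a) 0

variable {D : ∀ j : Fin J, Matrix (Fin (d j.castSucc)) (Fin (d j.succ)) ℝ} {κ : Fin (J + 1) → ℝ}
  {ρ : ℝ} {N : ℕ} {y : Fin (d 0) → ℝ}

theorem recurrentState_eq_codingState {n : ℕ} (e : Fin n ≃ CodingIndex d) (s p k : ℕ) (a : Fin n) :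
    recurrentState s p (fun a => codingInit (e a))
      (fun a b => LinearMap.toMatrix' (codingStep D κ ρ) (e a) (e b)) y k a =
      codingState D κ ρ (s ^ p) y k (e a) := by
  induction k generalizing a with
  | zero => rfl
  | succ k ih =>
    simp only [recurrentState, codingState, ih]
    rw [e.sum_comp fun b => LinearMap.toMatrix' (codingStep D κ ρ) (e a) b *
      codingState D κ ρ (s ^ p) y k b, ← LinearMap.toMatrix'_mulVec (codingStep D κ ρ)]
    rfl

theorem signPart_two_mul_add (y : Fin (d 0) → ℝ) (b : Bool) (i : Fin (d 0)) :
    signPart y (2 * (i : ℕ) + cond b 0 1) i = max (cond b 1 (-1) * y i) 0 := by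
  cases b <;> simp [signPart, pow_add, pow_mul]

theorem sum_range_two_mul (f : ℕ → ℝ) (N : ℕ) :
    ∑ c ∈ Finset.range (2 * N), f c = ∑ q ∈ Finset.range N, (f (2 * q) + f (2 * q + 1)) := by
  induction N with
  | zero => rfl
  | succ N ih =>
    rw [show 2 * (N + 1) = 2 * N + 1 + 1 by ring, Finset.sum_range_succ, Finset.sum_range_succ, ih,
      Finset.sum_range_succ, add_assoc]

/-- Positive and negative parts add up to absolute values, so one neuron with unit weights yields
the initial scale `‖y‖₁`. -/
theorem sum_signPart {m : ℕ} (y : Fin m → ℝ) (hN : m ≤ N) :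
    ∑ c ∈ Finset.range (2 * N), signPart y c (c / 2) = l1norm y := by
  have h : ∀ q, signPart y (2 * q) (2 * q / 2) + signPart y (2 * q + 1) ((2 * q + 1) / 2) =
      if h : q < m then |y ⟨q, h⟩| else 0 := fun q => by
    rw [show 2 * q / 2 = q by omega, show (2 * q + 1) / 2 = q by omega]
    unfold signPart
    split_ifs with hq
    · simp only [pow_add, pow_mul, neg_one_sq, one_pow, one_mul, pow_one, neg_mul]
      rcases le_total (y ⟨q, hq⟩) 0 with h | h
      · rw [max_eq_right h, max_eq_left (by linarith), abs_of_nonpos h, zero_add]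
      · rw [max_eq_left h, max_eq_right (by linarith), abs_of_nonneg h, add_zero]
    · exact add_zero 0
  rw [sum_range_two_mul, Finset.sum_congr rfl fun q _ => h q,
    ← Finset.sum_subset (Finset.range_mono hN) fun q _ hq => dif_neg fun h' =>
      hq (Finset.mem_range.2 h'), ← Fin.sum_univ_eq_sum_range (fun q =>
        if h : q < m then |y ⟨q, h⟩| else 0)]
  simp [l1norm]

theorem codingState_zero_inr (hN : d 0 ≤ N) : codingState D κ ρ N y 0 (.inr ()) = l1norm y := by
  simp only [codingState, codingInit, one_mul]
  rw [sum_signPart y hN, max_eq_left (l1norm_nonneg y)]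

theorem codingState_inr (hN : d 0 ≤ N) (hρ : 0 ≤ ρ) (k : ℕ) :
    codingState D κ ρ N y k (.inr ()) = ρ ^ k * l1norm y := by
  induction k with
  | zero => rw [codingState_zero_inr hN, pow_zero, one_mul]
  | succ k ih =>
    change max (ρ * codingState D κ ρ N y k (.inr ())) 0 = _
    have := l1norm_nonneg y
    rw [ih, max_eq_left (by positivity), pow_succ']
    ring

theorem codingValue_codingState_zero (hN : d 0 ≤ N) :
    codingValue (codingState D κ ρ N y 0) = Fin.cases y fun _ => 0 := by
  funext j i
  induction j using Fin.cases with
  | zero =>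
    have h : ∀ b, codingState D κ ρ N y 0 (.inl (b, ⟨0, i⟩)) = max (cond b 1 (-1) * y i) 0 :=
      fun b => by
        have hlt : 2 * (i : ℕ) + cond b 0 1 < 2 * N := by
          have := i.2
          cases b <;> simp <;> omega
        simp only [codingState, codingInit, true_and]
        rw [Finset.sum_eq_single_of_mem _ (Finset.mem_range.2 hlt)
          fun c _ hc => by rw [if_neg hc, zero_mul], if_pos rfl, one_mul,
          show (2 * (i : ℕ) + cond b 0 1) / 2 = i by cases b <;> (simp; try omega),
          signPart_two_mul_add, max_assoc, max_self]
    have h0 := softThreshold_zero (y i)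
    rw [softThreshold, sub_zero, sub_zero] at h0
    simp only [codingValue, h, Fin.cases_zero, cond_true, cond_false, one_mul, neg_mul]
    exact h0
  | succ j =>
    simp [codingValue, codingState, codingInit]

/-- The rectifiers of `g - κτ` and `-g - κτ` are the two halves of soft thresholding of `g`. The
threshold is read from the state, not from a bias. -/
theorem codingValue_codingState_succ (k : ℕ) :
    codingValue (codingState D κ ρ N y (k + 1)) =
      deepThresholdStep D κ (codingState D κ ρ N y k (.inr ()))
        (codingValue (codingState D κ ρ N y k)) := by
  funext j i
  simp [codingValue, codingState, codingStep, deepThresholdStep, softThreshold]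

theorem isCodeApprox_codingState {x : ∀ j : Fin (J + 1), Fin (d j) → ℝ} {Q r : ℝ}
    (hN : d 0 ≤ N) (hD : ∀ j, ColumnNormalized (D j))
    (hx : ∀ j, x j.castSucc = (D j).mulVec (x j.succ)) (hr : 0 ≤ r) (hr1 : r < 1)
    (hρ0 : 0 ≤ ρ) (hρ : ρ ≤ 1)
    (hxr : ∀ j : Fin J, (2 * (l0norm (x j.succ) : ℝ) - 1) * mutualCoherence (D j) ≤ r)
    (hQ : 0 ≤ Q) (hQd : ∀ j : Fin J, 2 * (d j.succ : ℝ) ≤ (ρ - r) * Q) (k : ℕ) :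
    IsCodeApprox x (codingValue (codingState D (thresholdFactor D Q) ρ N (x 0) k)) Q
      (ρ ^ k * l1norm (x 0)) := by
  induction k with
  | zero =>
    rw [codingValue_codingState_zero hN, pow_zero, one_mul]
    refine ⟨rfl, fun j => ?_, fun j => ?_⟩
    · induction j using Fin.cases with
      | zero => exact fun i hi => hi
      | succ j => exact fun i _ => rfl
    · induction j using Fin.cases with
      | zero => simpa [l1norm] using l1norm_nonneg (x 0)
      | succ j =>
        simpa using l1norm_le_pow_mul hD hx hρ hr1 hxr hQ hQd j.succ
  | succ k ih =>
    rw [codingValue_codingState_succ, codingState_inr hN hρ0, pow_succ', mul_assoc]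
    exact ih.step hD hx hr hρ0 hxr hQ (mul_nonneg (pow_nonneg hρ0 k) (l1norm_nonneg _)) hQd

end CodingState

/-! ### The loss of approximate codes -/

section Loss

variable {m n : ℕ} {A : Matrix (Fin m) (Fin n) ℝ} {γ : ℝ} {x z : Fin n → ℝ}

/-- The observation is `A x`, so the residual of `x` vanishes and only the `ℓ₁` terms need
comparing. -/
theorem loss_sub_loss_nonneg (hγ : 0 ≤ γ) (h : l1norm x ≤ l1norm z) :
    0 ≤ l2l1Loss γ A (A.mulVec x) z - l2l1Loss γ A (A.mulVec x) x := by
  have h1 := mul_le_mul_of_nonneg_left h hγ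
  have h2 := sq_nonneg (l2norm (A.mulVec x - A.mulVec z))
  have h3 : l2norm (A.mulVec x - A.mulVec x) = 0 := by simp [l2norm]
  rw [l2l1Loss, l2l1Loss, h3]
  linarith

theorem ColumnNormalized.loss_sub_loss_le (hA : ColumnNormalized A) (hγ : 0 ≤ γ) {E : ℝ}
    (h : l1norm (x - z) ≤ E) :
    l2l1Loss γ A (A.mulVec x) z - l2l1Loss γ A (A.mulVec x) x ≤ E ^ 2 + γ * E := by
  have h1 : l2norm (A.mulVec x - A.mulVec z) ^ 2 ≤ E ^ 2 := by
    rw [← Matrix.mulVec_sub]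
    exact pow_le_pow_left₀ (l2norm_nonneg _) ((hA.l2norm_mulVec_le _).trans h) 2
  have h2 : l1norm z ≤ l1norm x + E := by
    have := l1norm_add_le x (z - x)
    rw [add_sub_cancel, l1norm_sub_comm] at this
    linarith
  have h3 := mul_le_mul_of_nonneg_left h2 hγ
  have h4 := sq_nonneg (l2norm (A.mulVec x - A.mulVec x))
  unfold l2l1Loss
  linarith

/-- Scaling up an approximation with relative error `q` does not decrease the `ℓ₁` norm. -/
theorem l1norm_le_l1norm_smul {q : ℝ} (hq0 : 0 ≤ q) (hq : q ≤ 1 / 2)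
    (h : l1norm (x - z) ≤ q * l1norm x) : l1norm x ≤ l1norm ((1 + 2 * q) • z) := by
  have h1 := l1norm_add_le (x - z) z
  rw [sub_add_cancel] at h1
  have hx := l1norm_nonneg x
  rw [l1norm_smul, abs_of_pos (by linarith)]
  have h2 : (1 - q) * l1norm x ≤ l1norm z := by linarith
  have h3 := mul_le_mul_of_nonneg_left h2 (show 0 ≤ 1 + 2 * q by linarith)
  -- This is the surplus in `(1 + 2q)(1 - q) = 1 + q(1 - 2q)`.
  have h4 : 0 ≤ q * (1 - 2 * q) * l1norm x :=
    mul_nonneg (mul_nonneg hq0 (by linarith)) hx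
  linarith

theorem l1norm_sub_smul_le {q : ℝ} (hq0 : 0 ≤ q) (hq : q ≤ 1 / 2)
    (h : l1norm (x - z) ≤ q * l1norm x) : l1norm (x - (1 + 2 * q) • z) ≤ 4 * q * l1norm x := by
  have h1 : x - (1 + 2 * q) • z = (1 + 2 * q) • (x - z) + (-(2 * q)) • x := by
    ext i
    simp only [Pi.sub_apply, Pi.smul_apply, Pi.add_apply, smul_eq_mul]
    ring
  rw [h1]
  refine (l1norm_add_le _ _).trans ?_
  rw [l1norm_smul, l1norm_smul, abs_neg, abs_of_pos (by linarith), abs_of_nonneg (by linarith)]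
  have h2 := mul_le_mul_of_nonneg_left h (show 0 ≤ 1 + 2 * q by linarith)
  have h3 : 0 ≤ q * (1 - 2 * q) * l1norm x :=
    mul_nonneg (mul_nonneg hq0 (by linarith)) (l1norm_nonneg x)
  linarith

/-- The output `(1 + 2 q) z` for an approximation `z` with relative error `q ≤ 1 / 2`, and a
constant output otherwise. -/
theorem ColumnNormalized.loss_affine_bounds (hA : ColumnNormalized A) (hγ : 0 ≤ γ) {B q G : ℝ}
    (hq0 : 0 ≤ q) (hB : ∀ i, |x i| ≤ B) (hB0 : 0 ≤ B) (hG : n * B ≤ G)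
    (h : l1norm (x - z) ≤ q * l1norm x) {w : Fin n → ℝ}
    (hw : w = (if q ≤ 1 / 2 then 1 + 2 * q else 0) • z + fun _ => if q ≤ 1 / 2 then 0 else B) :
    0 ≤ l2l1Loss γ A (A.mulVec x) w - l2l1Loss γ A (A.mulVec x) x ∧
      l2l1Loss γ A (A.mulVec x) w - l2l1Loss γ A (A.mulVec x) x ≤
        (8 * G ^ 2 + 4 * G) * (1 + γ) * q := by
  have hxG : l1norm x ≤ G := (l1norm_le_mul hB).trans hG
  have hG0 : 0 ≤ G := (l1norm_nonneg x).trans hxG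
  have e1 : 0 ≤ G * q := mul_nonneg hG0 hq0
  have e2 : 0 ≤ G ^ 2 * q * γ := by positivity
  split_ifs at hw with hq
  · obtain rfl : w = (1 + 2 * q) • z := by rw [hw]; ext; simp
    refine ⟨loss_sub_loss_nonneg hγ (l1norm_le_l1norm_smul hq0 hq h), ?_⟩
    have h1 : l1norm (x - (1 + 2 * q) • z) ≤ 4 * q * G :=
      (l1norm_sub_smul_le hq0 hq h).trans (mul_le_mul_of_nonneg_left hxG (by linarith))
    refine (hA.loss_sub_loss_le hγ h1).trans ?_
    have e3 : 0 ≤ G ^ 2 * q * (1 - 2 * q) := mul_nonneg (by positivity) (by linarith)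
    linarith
  · obtain rfl : w = fun _ => B := by rw [hw]; ext; simp
    push Not at hq
    have h0 : l1norm x ≤ l1norm fun _ : Fin n => B := by
      refine (l1norm_le_mul hB).trans_eq ?_
      simp [l1norm, abs_of_nonneg hB0]
    refine ⟨loss_sub_loss_nonneg hγ h0, ?_⟩
    have h1 : l1norm (x - fun _ => B) ≤ 2 * G := by
      refine (l1norm_le_mul (b := 2 * B) fun i => ?_).trans (by linarith)
      have := abs_le.1 (hB i)
      rw [Pi.sub_apply, abs_le]
      constructor <;> linarith
    refine (hA.loss_sub_loss_le hγ h1).trans ?_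
    -- Here `2 * q > 1`, so a bound of constant size is also a bound proportional to `q`.
    have e3 : 0 ≤ (G ^ 2) * (2 * q - 1) := mul_nonneg (by positivity) (by linarith)
    have e4 : 0 ≤ γ * G * (2 * q - 1) := mul_nonneg (by positivity) (by linarith)
    linarith

end Loss

/-! ### The main theorem -/

section CodingNetwork

variable {s J : ℕ} {d : Fin (J + 1) → ℕ} {p : ℕ} (hs : 0 < s) (hd : 0 < d 0) (hp : d 0 ≤ s ^ p)
  (D : ∀ j : Fin J, Matrix (Fin (d j.castSucc)) (Fin (d j.succ)) ℝ) (κ : Fin (J + 1) → ℝ)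
  (ρ α β : ℝ) (K : ℕ)

/-- An enumeration of the channels of the recurrent network. -/
noncomputable def codingEquiv (d : Fin (J + 1) → ℕ) : Fin (2 * (∑ j, d j) + 1) ≃ CodingIndex d :=
  (Fintype.equivFinOfCardEq card_codingIndex).symm

/-- The network whose `j`-th output is `α z j + β`, where `z` is obtained from `K + j` steps of the
iteration. -/
noncomputable def codingNetwork : DeepCodingCNN s J d :=
  serialCNN hs (Nat.succ_pos _) hd hp (fun a => codingInit (codingEquiv d a))
    (fun a b => LinearMap.toMatrix' (codingStep D κ ρ) (codingEquiv d a) (codingEquiv d b))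
    (fun j i a => α * ((if codingEquiv d a = .inl (true, ⟨j.succ, i⟩) then 1 else 0) -
      (if codingEquiv d a = .inl (false, ⟨j.succ, i⟩) then 1 else 0)))
    (fun _ _ => β) K

theorem codingNetwork_output (y : Fin (d 0) → ℝ) (j : Fin J) :
    (codingNetwork hs hd hp D κ ρ α β K).output y j =
      α • codingValue (codingState D κ ρ (s ^ p) y (K + j)) j.succ + fun _ => β := by
  funext i
  unfold codingNetwork
  rw [serialCNN_output]
  simp only [recurrentState_eq_codingState]
  rw [(codingEquiv d).sum_comp fun a => α * ((if a = .inl (true, ⟨j.succ, i⟩) then 1 else 0) -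
      (if a = .inl (false, ⟨j.succ, i⟩) then 1 else 0)) *
        codingState D κ ρ (s ^ p) y (K + j) a]
  simp [mul_assoc, ← Finset.mul_sum, sub_mul, Finset.sum_sub_distrib, codingValue]

end CodingNetwork

theorem mainTheorem8 :
    -- `A s` is the constant of both `O`-bounds
    ∃ A : ℕ → ℝ, (∀ s, 0 < A s) ∧
    ∀ (J : ℕ), 1 ≤ J → ∀ (d : Fin (J + 1) → ℕ), (∀ j, 1 ≤ d j) →
    ∀ (D : ∀ j : Fin J, Matrix (Fin (d j.castSucc)) (Fin (d j.succ)) ℝ),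
      (∀ j, ColumnNormalized (D j)) →
    ∀ (lam : Fin J → ℝ≥0), (∀ j, UniquenessCondition (D j) (lam j)) →
    ∃ c : ℝ, 0 < c ∧
    ∀ B : ℝ, 0 ≤ B →
    ∃ C : ℝ, 0 < C ∧
    ∀ γ : ℝ, 0 < γ →
    ∀ s : ℕ, 2 ≤ s →
    ∀ K : ℕ, 1 ≤ K →
    ∃ N : DeepCodingCNN s J d,
      (N.depth : ℝ) ≤
        A s * (K * Real.logb s (∏ j : Fin J, ((d j.castSucc : ℝ) + d j.succ))) ∧
      (N.numWeights : ℝ) ≤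
        A s * (K * ∏ j : Fin J, ((d j.castSucc : ℝ) + d j.succ) ^ 2) ∧
      -- `x 0` is the observation, `x 1, …, x J` are its sparse codings
      ∀ x : (∀ j : Fin (J + 1), Fin (d j) → ℝ),
        IsDeepSparseCoding D lam 0 x →
        (∀ (j : Fin J) (i : Fin (d j.succ)), |x j.succ i| ≤ B) →
        ∀ j : Fin J,
          0 ≤ l2l1Loss γ (D j) (x j.castSucc) (N.output (x 0) j)
                - l2l1Loss γ (D j) (x j.castSucc) (x j.succ) ∧
          l2l1Loss γ (D j) (x j.castSucc) (N.output (x 0) j)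
                - l2l1Loss γ (D j) (x j.castSucc) (x j.succ)
            ≤ C * (1 + γ) * Real.exp (-c * K) := by
  refine ⟨fun s => 7 * s + 175 * s ^ 2 + 1, fun s => by positivity, ?_⟩
  intro J hJ d hd D hD lam hlam
  obtain ⟨r, hr0, hr1, hr⟩ := exists_coherence_bound hlam
  obtain ⟨ρ, hrρ, hρ1⟩ := exists_between hr1
  have hρ0 : 0 < ρ := hr0.trans_lt hrρ
  set R : ℝ := ((∑ j, d j : ℕ) : ℝ) with hR
  have hdR : ∀ j, (d j : ℝ) ≤ R := fun j => by
    rw [hR]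
    exact_mod_cast Finset.single_le_sum (f := d) (fun _ _ => Nat.zero_le _) (Finset.mem_univ j)
  have hR1 : 1 ≤ R := le_trans (by exact_mod_cast hd 0) (hdR 0)
  -- The maximum with `1` allows `Q ^ j ≤ Q ^ J` at the end.
  set Q : ℝ := max 1 (2 * R / (ρ - r)) with hQ
  have hQ1 : 1 ≤ Q := le_max_left _ _
  have hQd : ∀ j : Fin J, 2 * (d j.succ : ℝ) ≤ (ρ - r) * Q := fun j => by
    have h1 : 2 * R / (ρ - r) ≤ Q := le_max_right _ _
    rw [div_le_iff₀ (sub_pos.2 hrρ)] at h1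
    linarith [hdR j.succ]
  set H : ℝ := (Q * R) ^ J with hH
  have hH0 : 0 ≤ H := by positivity
  refine ⟨-Real.log ρ, neg_pos.2 (Real.log_neg hρ0 hρ1), fun B hB => ?_⟩
  -- The summand `1` only keeps the constant positive, for instance when `B = 0`.
  refine ⟨(8 * (R * B) ^ 2 + 4 * (R * B)) * H + 1, by positivity, ?_⟩
  intro γ hγ s hs K hK
  set q : ℝ := H * ρ ^ K with hq
  have hq0 : 0 ≤ q := by positivity
  have hs0 : 0 < s := by omega
  have hp := Nat.le_pow_clog hs (d 0)
  have hp' := pow_clog_le_mul hs (hd 0)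
  have hL := depth_le hJ hd hs hK hp'
  have hW := weights_count_le hJ hd hs hK rfl hp'
  -- The bound `q` does not depend on the input, so the choice between the scaled and the constant
  -- output is made when the network is built.
  refine ⟨codingNetwork hs0 (hd 0) hp D (thresholdFactor D Q) ρ
    (if q ≤ 1 / 2 then 1 + 2 * q else 0) (if q ≤ 1 / 2 then 0 else B) K, ?_, ?_, ?_⟩
  · have hn : (0 : ℝ) ≤ K * Real.logb s (∏ j : Fin J, ((d j.castSucc : ℝ) + d j.succ)) :=
      nonneg_of_mul_nonneg_right ((Nat.cast_nonneg _).trans hL) (by positivity)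
    refine hL.trans (mul_le_mul_of_nonneg_right ?_ hn)
    have : (0 : ℝ) ≤ 175 * (s : ℝ) ^ 2 := by positivity
    linarith
  · unfold codingNetwork
    rw [serialCNN_numWeights]
    have h := (Nat.cast_le (α := ℝ)).2 hW
    refine h.trans ?_
    rw [Finset.prod_pow]
    push_cast
    refine mul_le_mul_of_nonneg_right ?_ (by positivity)
    have : (0 : ℝ) ≤ 7 * (s : ℝ) := by positivity
    linarith
  · intro x hx hxB j
    have hxD := hx.eq_mulVec
    have hxr : ∀ j : Fin J, (2 * (l0norm (x j.succ) : ℝ) - 1) * mutualCoherence (D j) ≤ r :=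
      fun j => le_trans (mul_le_mul_of_nonneg_right (by linarith [(hx j).2])
        (mutualCoherence_nonneg _)) (hr j)
    have happrox := (isCodeApprox_codingState hp hD hxD hr0 hr1 hρ0.le hρ1.le hxr
      (zero_le_one.trans hQ1) hQd (K + j)).error j.succ
    have herr : l1norm (x j.succ - codingValue (codingState D (thresholdFactor D Q) ρ
        (s ^ Nat.clog s (d 0)) (x 0) (K + j)) j.succ) ≤ q * l1norm (x j.succ) := by
      have hx0 := l1norm_nonneg (x j.succ)
      have h0 := l1norm_zero_le_pow_mul hD hxD hdR j.succ
      have hjJ : (j.succ : ℕ) ≤ J := by rw [Fin.val_succ]; exact j.2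
      have h1 : ρ ^ (K + (j : ℕ)) ≤ ρ ^ K :=
        pow_le_pow_of_le_one hρ0.le hρ1.le (Nat.le_add_right _ _)
      have h2 : Q ^ (j.succ : ℕ) ≤ Q ^ J := pow_le_pow_right₀ hQ1 hjJ
      have h3 : R ^ (j.succ : ℕ) ≤ R ^ J := pow_le_pow_right₀ hR1 hjJ
      calc _ ≤ Q ^ (j.succ : ℕ) * (ρ ^ (K + (j : ℕ)) * l1norm (x 0)) := happrox
        _ ≤ Q ^ (j.succ : ℕ) * (ρ ^ (K + (j : ℕ)) * (R ^ (j.succ : ℕ) * l1norm (x j.succ))) := by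
          gcongr
        _ ≤ Q ^ J * (ρ ^ K * (R ^ J * l1norm (x j.succ))) := by gcongr
        _ = q * l1norm (x j.succ) := by rw [hq, hH, mul_pow]; ring
    have hmain := (hD j).loss_affine_bounds hγ.le hq0 (hxB j) hB
      (mul_le_mul_of_nonneg_right (hdR j.succ) hB) herr
      (codingNetwork_output hs0 (hd 0) hp D (thresholdFactor D Q) ρ _ _ K (x 0) j)
    rw [← hxD j] at hmain
    refine ⟨hmain.1, hmain.2.trans ?_⟩
    have hexp : Real.exp (- -Real.log ρ * K) = ρ ^ K := by
      rw [neg_neg, mul_comm, Real.exp_nat_mul, Real.exp_log hρ0]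
    rw [hexp, hq]
    have : 0 ≤ (1 + γ) * ρ ^ K := by positivity
    linarith
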